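/- **Setting.** Let $N$ be a $(2n+1)$-dimensional smooth manifold with a Riemannian metric $g$, Levi-Civita connection $\bar\nabla$ and an almost contact metric structure $(\phi,\xi,\eta,g)$, that is, $\phi^2X=-X+\eta(X)\xi$, $\phi\xi=0$, $\eta(\xi)=1$, $g(X,\xi)=\eta(X)$, $\eta(\phi X)=0$, $g(\phi X,\phi Y)=g(X,Y)-\eta(X)\eta(Y)$, $g(\phi X,Y)=-g(X,\phi Y)$. Assume that it is an *SQ-Sasakian* (special quasi-Sasakian) manifold with structure function $\beta$: $\beta$ is a smooth function on $N$ with $\xi\beta=0$, the form $\Phi(X,Y)=g(X,\phi Y)$ is closed, $\bar\nabla_X\xi=-\beta\,\phi X$, and the structure is normal, i.e. $[\phi X,\phi Y]+\phi^2[X,Y]-\phi[\phi X,Y]-\phi[X,\phi Y]+2\,d\eta(X,Y)\,\xi=0$ (where $2\,d\eta(X,Y)=X\eta(Y)-Y\eta(X)-\eta([X,Y])$). Let $M$ be a $(2m+1)$-dimensional immersed *invariant* submanifold: $\xi$ is tangent to $M$ and $\phi(TM)\subset TM$. Let $\nabla$, $\nabla^\perp$, $h$ be the induced connection, the normal connection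 and the second fundamental form. For a bilinear form $B$ on $TM$ with values in the normal bundle put $(\nabla_XB)(Y,Z)=\nabla^\perp_X(B(Y,Z))-B(\nabla_XY,Z)-B(Y,\nabla_XZ)$, and let $$\bar R(X,Y)\cdot h=(\nabla_X\nabla_Y-\nabla_Y\nabla_X-\nabla_{[X,Y]})h,$$ $$Q(g,h)(Z,U;X,Y)=g(Y,Z)h(X,U)-g(X,Z)h(Y,U)+g(Y,U)h(X,Z)-g(X,U)h(Y,Z).$$ Consider the following statements (vector fields are tangent to $M$). 1. $M$ is totally geodesic: $h=0$. 2. $M$ is parallel: $\nabla h=0$. 3. $M$ is semiparallel: $\bar R(X,Y)\cdot h=0$ for all $X,Y$. 4. $M$ is Chaki-pseudo parallel with $\alpha(\xi)^2+\beta^2\neq0$: there is a smooth nowhere vanishing $1$-form $\alpha$ on $M$ such that $(\nabla_Xh)(Y,Z)=2\alpha(X)h(Y,Z)+\alpha(Y)h(X,Z)+\alpha(Z)h(X,Y)$ for all $X,Y,Z$, and $\alpha(\xi)^2+\beta^2$ vanishes nowhere on $M$. 5. $M$ is Deszcz-pseudo parallel with $L_h+\beta^2\neq0$: there is a function $L_h$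 on $W=\{x\in M:(h-Hg)_x\neq0\}$, where $H$ is the mean curvature vector, such that $(\bar R(X,Y)\cdot h)(Z,U)=L_h\,Q(g,h)(Z,U;X,Y)$ on $W$ for all $X,Y,Z,U$, and $L_h+\beta^2$ vanishes nowhere on $W$. **Theorem.** Statements 1, 4 and 5 are equivalent, and they imply 2 and 3. If moreover $\beta$ vanishes nowhere on $M$, then all five statements 1–5 are equivalent. -/

import Mathlib

open Bundle Manifold
open scoped ContDiff Manifold

noncomputable section

namespace SQSasakian

section Fields

variable {E : Type*} [NormedAddCommGroup E] [NormedSpace ℝ E]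
  {H : Type*} [TopologicalSpace H] (I : ModelWithCorners ℝ E H)
  {M : Type*} [TopologicalSpace M] [ChartedSpace H M]

/-- `X` is a smooth vector field on the manifold. -/
def IsSmoothField [IsManifold I ∞ M] (X : (x : M) → TangentSpace I x) : Prop :=
  ContMDiff I I.tangent ∞ (fun x ↦ (⟨x, X x⟩ : TangentBundle I M))

/-- `α` is a smooth `1`-form: its value on every smooth vector field is a smooth function. -/
def IsSmoothOneForm [IsManifold I ∞ M] (α : (x : M) → TangentSpace I x →L[ℝ] ℝ) : Prop :=
  ∀ X : (x : M) → TangentSpace I x, IsSmoothField I X →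
    ContMDiff I 𝓘(ℝ, ℝ) ∞ (fun x ↦ α x (X x))

/-- `φ` is a smooth tensor field of type `(1,1)`, i.e. a smooth section of `Hom(TM, TM)`. -/
def IsSmoothEndomorphism [IsManifold I ∞ M]
    (φ : (x : M) → TangentSpace I x →L[ℝ] TangentSpace I x) : Prop :=
  ContMDiff I (I.prod 𝓘(ℝ, E →L[ℝ] E)) ∞
    (fun x ↦ TotalSpace.mk' (E →L[ℝ] E)
      (E := fun x : M ↦ TangentSpace I x →L[ℝ] TangentSpace I x) x (φ x))

/-- The derivative `X u` of a function `u` along a vector field `X`. -/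
def lieDerivFun (X : (x : M) → TangentSpace I x) (u : M → ℝ) (x : M) : ℝ :=
  mvfderiv I u x (X x)

/-- The exterior derivative of a `1`-form, with the convention
`2 dη(X, Y) = X(η(Y)) - Y(η(X)) - η([X, Y])` (for which a Sasakian structure has `Φ = dη`). -/
def extDerivOne (η : (x : M) → TangentSpace I x →L[ℝ] ℝ)
    (X Y : (x : M) → TangentSpace I x) (x : M) : ℝ :=
  (1 / 2) * (lieDerivFun I X (fun y ↦ η y (Y y)) x - lieDerivFun I Y (fun y ↦ η y (X y)) x
    - η x (VectorField.mlieBracket I X Y x))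

/-- The exterior derivative of a `2`-form `Ω`, with the convention
`3 dΩ(X, Y, Z) = 𝔖 (X(Ω(Y, Z)) - Ω([X, Y], Z))`, where `𝔖` is the cyclic sum. -/
def extDerivTwo (Ω : (x : M) → TangentSpace I x → TangentSpace I x → ℝ)
    (X Y Z : (x : M) → TangentSpace I x) (x : M) : ℝ :=
  (1 / 3) * (lieDerivFun I X (fun y ↦ Ω y (Y y) (Z y)) x
    + lieDerivFun I Y (fun y ↦ Ω y (Z y) (X y)) x
    + lieDerivFun I Z (fun y ↦ Ω y (X y) (Y y)) x
    - Ω x (VectorField.mlieBracket I X Y x) (Z x)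
    - Ω x (VectorField.mlieBracket I Y Z x) (X x)
    - Ω x (VectorField.mlieBracket I Z X x) (Y x))

/-- The Nijenhuis tensor of an almost contact structure:
`N(X,Y) = [φX, φY] + φ²[X,Y] - φ[φX, Y] - φ[X, φY] + 2 dη(X,Y) ξ`. -/
def nijenhuis (φ : (x : M) → TangentSpace I x →L[ℝ] TangentSpace I x)
    (ξ : (x : M) → TangentSpace I x) (η : (x : M) → TangentSpace I x →L[ℝ] ℝ)
    (X Y : (x : M) → TangentSpace I x) (x : M) : TangentSpace I x :=
  VectorField.mlieBracket I (fun y ↦ φ y (X y)) (fun y ↦ φ y (Y y)) x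
    + φ x (φ x (VectorField.mlieBracket I X Y x))
    - φ x (VectorField.mlieBracket I (fun y ↦ φ y (X y)) Y x)
    - φ x (VectorField.mlieBracket I X (fun y ↦ φ y (Y y)) x)
    + (2 * extDerivOne I η X Y x) • ξ x

end Fields

section Ambient

variable {E : Type*} [NormedAddCommGroup E] [NormedSpace ℝ E] [FiniteDimensional ℝ E]
  [CompleteSpace E]
  {H : Type*} [TopologicalSpace H] (J : ModelWithCorners ℝ E H)
  (N : Type*) [TopologicalSpace N] [ChartedSpace H N] [IsManifold J ∞ N]
  [RiemannianBundle (fun p : N ↦ TangentSpace J p)]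
  [IsContMDiffRiemannianBundle J ∞ E (fun p : N ↦ TangentSpace J p)]

/-- `nabla` is the Levi-Civita connection: it is torsion-free and compatible with the metric,
`u g(Y, Z) = g(∇_u Y, Z) + g(Y, ∇_u Z)`. Note that `nabla Y p u` is `(∇_u Y)(p)`. -/
def IsLeviCivita (nabla : CovariantDerivative J E (fun p : N ↦ TangentSpace J p)) : Prop :=
  nabla.torsion = 0 ∧
  ∀ (Y Z : (p : N) → TangentSpace J p) (p : N),
    MDifferentiableAt J J.tangent (fun q ↦ (⟨q, Y q⟩ : TangentBundle J N)) p →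
    MDifferentiableAt J J.tangent (fun q ↦ (⟨q, Z q⟩ : TangentBundle J N)) p →
    ∀ u : TangentSpace J p,
      mvfderiv J (fun q ↦ (inner ℝ (Y q) (Z q) : ℝ)) p u
        = inner ℝ (nabla Y p u) (Z p) + inner ℝ (Y p) (nabla Z p u)

/-- An almost contact metric structure `(φ, ξ, η, g)` on a Riemannian manifold `(N, g)`. -/
structure AlmostContactMetric where
  φ : (p : N) → TangentSpace J p →L[ℝ] TangentSpace J p
  ξ : (p : N) → TangentSpace J p
  η : (p : N) → TangentSpace J p →L[ℝ] ℝ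
  smooth_φ : IsSmoothEndomorphism J φ
  smooth_ξ : IsSmoothField J ξ
  smooth_η : IsSmoothOneForm J η
  φ_sq : ∀ p (X : TangentSpace J p), φ p (φ p X) = -X + η p X • ξ p
  φ_ξ : ∀ p, φ p (ξ p) = 0
  η_ξ : ∀ p, η p (ξ p) = 1
  inner_ξ : ∀ p (X : TangentSpace J p), inner ℝ X (ξ p) = η p X
  η_φ : ∀ p (X : TangentSpace J p), η p (φ p X) = 0
  inner_φ_φ : ∀ p (X Y : TangentSpace J p),
    inner ℝ (φ p X) (φ p Y) = inner ℝ X Y - η p X * η p Y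
  inner_φ : ∀ p (X Y : TangentSpace J p), inner ℝ (φ p X) Y = -inner ℝ X (φ p Y)

variable {J N}

/-- The fundamental `2`-form `Φ(X, Y) = g(X, φ Y)`. -/
def AlmostContactMetric.fundamentalForm (S : AlmostContactMetric J N) (p : N)
    (X Y : TangentSpace J p) : ℝ :=
  inner ℝ X (S.φ p Y)

/-- The almost contact metric structure `S` is special quasi-Sasakian with structure function `β`;
`nabla` is the Levi-Civita connection. -/
structure IsSQSasakian (S : AlmostContactMetric J N)
    (nabla : CovariantDerivative J E (fun p : N ↦ TangentSpace J p)) (β : N → ℝ) : Prop where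
  /-- `dΦ = 0` -/
  closed : ∀ X Y Z : (p : N) → TangentSpace J p,
    IsSmoothField J X → IsSmoothField J Y → IsSmoothField J Z →
      ∀ p, extDerivTwo J S.fundamentalForm X Y Z p = 0
  /-- `(φ, ξ, η)` is normal -/
  normal : ∀ X Y : (p : N) → TangentSpace J p, IsSmoothField J X → IsSmoothField J Y →
    ∀ p, nijenhuis J S.φ S.ξ S.η X Y p = 0
  smooth_β : ContMDiff J 𝓘(ℝ, ℝ) ∞ β
  /-- `ξ β = 0` -/
  ξ_β : ∀ p, lieDerivFun J S.ξ β p = 0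
  /-- `∇_X ξ = -β φ X` -/
  nabla_ξ : ∀ p (X : TangentSpace J p), nabla S.ξ p X = -(β p • S.φ p X)

end Ambient

section Submanifold

variable {E : Type*} [NormedAddCommGroup E] [NormedSpace ℝ E] [FiniteDimensional ℝ E]
  {H : Type*} [TopologicalSpace H] (I : ModelWithCorners ℝ E H)
  {M : Type*} [TopologicalSpace M] [ChartedSpace H M] [IsManifold I ∞ M]
  {E' : Type*} [NormedAddCommGroup E'] [NormedSpace ℝ E'] [FiniteDimensional ℝ E']
  {H' : Type*} [TopologicalSpace H'] (J : ModelWithCorners ℝ E' H')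
  {N : Type*} [TopologicalSpace N] [ChartedSpace H' N] [IsManifold J ∞ N]

/-- `f` is a smooth immersion; it presents `M` as an (immersed) submanifold of `N`. -/
def IsSmoothImmersion (f : M → N) : Prop :=
  ContMDiff I J ∞ f ∧ ∀ x, Function.Injective (mfderiv I J f x)

/-- The tangent space of the submanifold at `x`, as a subspace of the ambient tangent space. -/
def tangentRange (f : M → N) (x : M) : Submodule ℝ (TangentSpace J (f x)) :=
  LinearMap.range (mfderiv I J f x : TangentSpace I x →ₗ[ℝ] TangentSpace J (f x))

/-- The vector field along `f` given by a vector field `Y` on `M`, i.e. `Y` regarded as a field of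
ambient tangent vectors. -/
def push (f : M → N) (Y : (x : M) → TangentSpace I x) (x : M) : TangentSpace J (f x) :=
  mfderiv I J f x (Y x)

/-- The ambient covariant derivative `∇̄_u V` at `x` of a vector field `V` along `f` in the direction
`u ∈ T_x M` (the pullback connection): in the trivialization of the ambient tangent bundle at `f x`,
it is the derivative of the components of `V` plus the Christoffel term, the latter being the
ambient covariant derivative of the section with the constant components of `V x`. -/
def covAlong (nabla : CovariantDerivative J E' (fun p : N ↦ TangentSpace J p)) (f : M → N)
    (V : (x : M) → TangentSpace J (f x)) (x : M) (u : TangentSpace I x) : TangentSpace J (f x) :=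
  (trivializationAt E' (TangentSpace J : N → Type _) (f x)).symmL ℝ (f x)
      (mvfderiv I (fun y ↦ (trivializationAt E' (TangentSpace J : N → Type _) (f x)
        (⟨f y, V y⟩ : TangentBundle J N)).2) x u)
    + nabla (FiberBundle.extend E' (V x)) (f x) (mfderiv I J f x u)

variable [RiemannianBundle (fun p : N ↦ TangentSpace J p)]

instance (f : M → N) (x : M) : FiniteDimensional ℝ (tangentRange I J f x) :=
  haveI : FiniteDimensional ℝ (TangentSpace J (f x)) := inferInstanceAs (FiniteDimensional ℝ E')
  inferInstance

/-- The component tangent to the submanifold of an ambient vector `w`, as a vector of `T_x M`: the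
vector whose image under `df` is the orthogonal projection of `w` to the tangent space. -/
def tangentPart (f : M → N) (x : M) (w : TangentSpace J (f x)) : TangentSpace I x :=
  Function.invFun (mfderiv I J f x) ((tangentRange I J f x).starProjection w)

/-- The component normal to the submanifold of an ambient vector `w`. -/
def normalPart (f : M → N) (x : M) (w : TangentSpace J (f x)) : TangentSpace J (f x) :=
  w - (tangentRange I J f x).starProjection w

/-- The induced metric on `M`. -/
def inducedMetric (f : M → N) (x : M) (u v : TangentSpace I x) : ℝ :=
  inner ℝ (mfderiv I J f x u) (mfderiv I J f x v)

variable (nabla : CovariantDerivative J E' (fun p : N ↦ TangentSpace J p)) (f : M → N)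

/-- The induced connection `∇_X Y`: the tangential part of `∇̄_X Y`. -/
def inducedConn (X Y : (x : M) → TangentSpace I x) (x : M) : TangentSpace I x :=
  tangentPart I J f x (covAlong I J nabla f (push I J f Y) x (X x))

/-- The normal connection `∇^⊥_X V` on fields of ambient vectors along the submanifold. -/
def normalConn (X : (x : M) → TangentSpace I x) (V : (x : M) → TangentSpace J (f x)) (x : M) :
    TangentSpace J (f x) :=
  normalPart I J f x (covAlong I J nabla f V x (X x))

/-- The second fundamental form `h_x(u, v)`: the normal part of `∇̄_u Y`, where `Y` is the local
extension of `v` with constant components in the trivialization of `TM` at `x`. -/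
def secondFundForm (x : M) (u v : TangentSpace I x) : TangentSpace J (f x) :=
  normalPart I J f x (covAlong I J nabla f (push I J f (FiberBundle.extend E v)) x u)

/-- The second fundamental form on vector fields, `(Y, Z) ↦ h(Y, Z)`. -/
def secondFundField (Y Z : (x : M) → TangentSpace I x) (x : M) : TangentSpace J (f x) :=
  secondFundForm I J nabla f x (Y x) (Z x)

/-- The covariant derivative of a bilinear form `B` on `TM` with values in the normal bundle:
`(∇_X B)(Y, Z) = ∇^⊥_X (B(Y, Z)) - B(∇_X Y, Z) - B(Y, ∇_X Z)`. -/
def covForm (X : (x : M) → TangentSpace I x)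
    (B : ((x : M) → TangentSpace I x) → ((x : M) → TangentSpace I x) →
      (x : M) → TangentSpace J (f x))
    (Y Z : (x : M) → TangentSpace I x) (x : M) : TangentSpace J (f x) :=
  normalConn I J nabla f X (B Y Z) x
    - B (inducedConn I J nabla f X Y) Z x - B Y (inducedConn I J nabla f X Z) x

/-- `R̄(X, Y) · h = (∇_X ∇_Y - ∇_Y ∇_X - ∇_{[X, Y]}) h`. -/
def curvatureAction (X Y Z U : (x : M) → TangentSpace I x) (x : M) : TangentSpace J (f x) :=
  covForm I J nabla f X (covForm I J nabla f Y (secondFundField I J nabla f)) Z U x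
    - covForm I J nabla f Y (covForm I J nabla f X (secondFundField I J nabla f)) Z U x
    - covForm I J nabla f (VectorField.mlieBracket I X Y) (secondFundField I J nabla f) Z U x

/-- `Q(g, h)(Z, U; X, Y) = g(Y,Z) h(X,U) - g(X,Z) h(Y,U) + g(Y,U) h(X,Z) - g(X,U) h(Y,Z)`. -/
def tachibana (x : M) (Z U X Y : TangentSpace I x) : TangentSpace J (f x) :=
  inducedMetric I J f x Y Z • secondFundForm I J nabla f x X U
    - inducedMetric I J f x X Z • secondFundForm I J nabla f x Y U
    + inducedMetric I J f x Y U • secondFundForm I J nabla f x X Z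
    - inducedMetric I J f x X U • secondFundForm I J nabla f x Y Z

/-- The mean curvature vector `H = (1 / dim M) ∑ h(eᵢ, eᵢ)`, with `(eᵢ)` orthonormal. -/
def meanCurvature (x : M) : TangentSpace J (f x) :=
  (Module.finrank ℝ E : ℝ)⁻¹ •
    ∑ i, secondFundForm I J nabla f x
      (tangentPart I J f x (stdOrthonormalBasis ℝ (tangentRange I J f x) i))
      (tangentPart I J f x (stdOrthonormalBasis ℝ (tangentRange I J f x) i))

/-- The set `W = {x ∈ M : (h - H g)_x ≠ 0}`. -/
def nonUmbilicSet : Set M :=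
  {x | ∃ u v : TangentSpace I x,
    secondFundForm I J nabla f x u v - inducedMetric I J f x u v • meanCurvature I J nabla f x ≠ 0}

/-- `M` is totally geodesic: `h = 0`. -/
def IsTotallyGeodesic : Prop :=
  ∀ (x : M) (u v : TangentSpace I x), secondFundForm I J nabla f x u v = 0

/-- `M` is parallel: `∇h = 0`. -/
def IsParallel : Prop :=
  ∀ X Y Z : (x : M) → TangentSpace I x,
    IsSmoothField I X → IsSmoothField I Y → IsSmoothField I Z →
      ∀ x, covForm I J nabla f X (secondFundField I J nabla f) Y Z x = 0

/-- `M` is semiparallel: `R̄ · h = 0`. -/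
def IsSemiparallel : Prop :=
  ∀ X Y Z U : (x : M) → TangentSpace I x,
    IsSmoothField I X → IsSmoothField I Y → IsSmoothField I Z → IsSmoothField I U →
      ∀ x, curvatureAction I J nabla f X Y Z U x = 0

/-- `M` is Chaki-pseudo parallel with the nowhere vanishing `1`-form `α`. -/
def IsChakiPseudoParallel (α : (x : M) → TangentSpace I x →L[ℝ] ℝ) : Prop :=
  IsSmoothOneForm I α ∧ (∀ x, α x ≠ 0) ∧
  ∀ X Y Z : (x : M) → TangentSpace I x,
    IsSmoothField I X → IsSmoothField I Y → IsSmoothField I Z →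
      ∀ x, covForm I J nabla f X (secondFundField I J nabla f) Y Z x
        = (2 * α x (X x)) • secondFundForm I J nabla f x (Y x) (Z x)
          + α x (Y x) • secondFundForm I J nabla f x (X x) (Z x)
          + α x (Z x) • secondFundForm I J nabla f x (X x) (Y x)

/-- `M` is Deszcz-pseudo parallel with the function `L` on `W`: `R̄ · h = L Q(g, h)` on `W`. -/
def IsDeszczPseudoParallel (L : nonUmbilicSet I J nabla f → ℝ) : Prop :=
  ∀ X Y Z U : (x : M) → TangentSpace I x,
    IsSmoothField I X → IsSmoothField I Y → IsSmoothField I Z → IsSmoothField I U →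
      ∀ x : nonUmbilicSet I J nabla f, curvatureAction I J nabla f X Y Z U x
        = L x • tachibana I J nabla f x (Z x) (U x) (X x) (Y x)

/-- `M` is an invariant submanifold: `ξ` is tangent to `M` and `φ(TM) ⊆ TM`. -/
def IsInvariant [IsContMDiffRiemannianBundle J ∞ E' (fun p : N ↦ TangentSpace J p)]
    (S : AlmostContactMetric J N) : Prop :=
  ∀ x, S.ξ (f x) ∈ tangentRange I J f x ∧
    ∀ w ∈ tangentRange I J f x, S.φ (f x) w ∈ tangentRange I J f x

/-- The vector field `ξ` regarded as a vector field on the submanifold (to which it is tangent when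
the submanifold is invariant). -/
def restrictedReeb (f : M → N) [IsContMDiffRiemannianBundle J ∞ E' (fun p : N ↦ TangentSpace J p)]
    (S : AlmostContactMetric J N) (x : M) : TangentSpace I x :=
  tangentPart I J f x (S.ξ (f x))

/-- `M` is Chaki-pseudo parallel with `α(ξ)² + β² ≠ 0` (everywhere on `M`). -/
def IsChakiCase [IsContMDiffRiemannianBundle J ∞ E' (fun p : N ↦ TangentSpace J p)]
    (S : AlmostContactMetric J N) (β : N → ℝ) : Prop :=
  ∃ α : (x : M) → TangentSpace I x →L[ℝ] ℝ, IsChakiPseudoParallel I J nabla f α ∧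
    ∀ x, (α x (restrictedReeb I J f S x)) ^ 2 + β (f x) ^ 2 ≠ 0

/-- `M` is Deszcz-pseudo parallel with `L_h + β² ≠ 0` (everywhere on `W`). -/
def IsDeszczCase (β : N → ℝ) : Prop :=
  ∃ L : nonUmbilicSet I J nabla f → ℝ, IsDeszczPseudoParallel I J nabla f L ∧
    ∀ x : nonUmbilicSet I J nabla f, L x + β (f x) ^ 2 ≠ 0

end Submanifold

end SQSasakian

end

noncomputable section

set_option linter.unusedSectionVars false

namespace SQSasakian

section CovAlong

open Filter Topology

variable {E : Type*} [NormedAddCommGroup E] [NormedSpace ℝ E]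
  {H : Type*} [TopologicalSpace H] (I : ModelWithCorners ℝ E H)
  {M : Type*} [TopologicalSpace M] [ChartedSpace H M]
  {E' : Type*} [NormedAddCommGroup E'] [NormedSpace ℝ E']
  {H' : Type*} [TopologicalSpace H'] (J : ModelWithCorners ℝ E' H')
  {N : Type*} [TopologicalSpace N] [ChartedSpace H' N] [IsManifold J ∞ N]

/-- The vector field `V` along `f` is differentiable at `x`. -/
abbrev DiffAlongAt (f : M → N) (V : (x : M) → TangentSpace J (f x)) (x : M) : Prop :=
  MDifferentiableAt I J.tangent (fun y ↦ (⟨f y, V y⟩ : TangentBundle J N)) x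

/-- The components of a vector field along `f` in the trivialization at `f x`. -/
def coordAlong (f : M → N) (V : (x : M) → TangentSpace J (f x)) (x y : M) : E' :=
  (trivializationAt E' (TangentSpace J : N → Type _) (f x) (⟨f y, V y⟩ : TangentBundle J N)).2

variable {I J}

lemma diffAlongAt_iff {f : M → N} {V : (x : M) → TangentSpace J (f x)} {x : M} :
    DiffAlongAt I J f V x ↔
      MDifferentiableAt I J f x ∧ MDifferentiableAt I 𝓘(ℝ, E') (coordAlong J f V x) x :=
  mdifferentiableAt_totalSpace J _

lemma eventually_mem_baseSet {f : M → N} {x : M} (hf : ContinuousAt f x) :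
    ∀ᶠ y in 𝓝 x, f y ∈ (trivializationAt E' (TangentSpace J : N → Type _) (f x)).baseSet :=
  hf.eventually_mem ((trivializationAt E' (TangentSpace J : N → Type _) (f x)).open_baseSet.mem_nhds
    (FiberBundle.mem_baseSet_trivializationAt' (f x)))

lemma coordAlong_eq {f : M → N} (V : (x : M) → TangentSpace J (f x)) {x y : M}
    (h : f y ∈ (trivializationAt E' (TangentSpace J : N → Type _) (f x)).baseSet) :
    coordAlong J f V x y =
      (trivializationAt E' (TangentSpace J : N → Type _) (f x)).continuousLinearMapAt ℝ (f y)
        (V y) := by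
  rw [Trivialization.continuousLinearMapAt_apply, Trivialization.linearMapAt_apply, if_pos h]
  rfl

lemma symmL_coordAlong {f : M → N} (V : (x : M) → TangentSpace J (f x)) {x y : M}
    (h : f y ∈ (trivializationAt E' (TangentSpace J : N → Type _) (f x)).baseSet) :
    (trivializationAt E' (TangentSpace J : N → Type _) (f x)).symmL ℝ (f y) (coordAlong J f V x y)
      = V y := by
  rw [coordAlong_eq V h, Trivialization.symmL_continuousLinearMapAt _ h]

lemma extend_eq_symmL {p : N} (v : TangentSpace J p) {q : N}
    (hq : q ∈ (trivializationAt E' (TangentSpace J : N → Type _) p).baseSet) :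
    FiberBundle.extend E' v q =
      (trivializationAt E' (TangentSpace J : N → Type _) p).symmL ℝ q
        ((trivializationAt E' (TangentSpace J : N → Type _) p).continuousLinearMapAt ℝ p v) := by
  rw [Trivialization.continuousLinearMapAt_apply, Trivialization.linearMapAt_apply,
    if_pos (FiberBundle.mem_baseSet_trivializationAt' p), Trivialization.symmL_apply _ hq]
  rfl

lemma continuousLinearMapAt_extend {p : N} (v : TangentSpace J p) {q : N}
    (hq : q ∈ (trivializationAt E' (TangentSpace J : N → Type _) p).baseSet) :
    (trivializationAt E' (TangentSpace J : N → Type _) p).continuousLinearMapAt ℝ q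
      (FiberBundle.extend E' v q) =
    (trivializationAt E' (TangentSpace J : N → Type _) p).continuousLinearMapAt ℝ p v := by
  rw [extend_eq_symmL _ hq, Trivialization.continuousLinearMapAt_symmL _ hq]

lemma mdifferentiableAt_extend {p : N} (v : TangentSpace J p) :
    MDifferentiableAt J J.tangent
      (fun q ↦ (⟨q, FiberBundle.extend E' v q⟩ : TangentBundle J N)) p :=
  FiberBundle.mdifferentiableAt_extend J E' v

lemma mvfderiv_congr {F : Type*} [NormedAddCommGroup F] [NormedSpace ℝ F] {g g' : M → F} {x : M}
    (h : g =ᶠ[𝓝 x] g') : mvfderiv I g x = mvfderiv I g' x := by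
  ext u
  simp only [mvfderiv, h.mfderiv_eq]
  rfl

variable {f : M → N} {x : M} (nabla : CovariantDerivative J E' (fun p : N ↦ TangentSpace J p))

lemma eventually_mem_baseSet_self (p : N) :
    ∀ᶠ q in 𝓝 p, q ∈ (trivializationAt E' (TangentSpace J : N → Type _) p).baseSet :=
  (trivializationAt E' (TangentSpace J : N → Type _) p).open_baseSet.mem_nhds
    (FiberBundle.mem_baseSet_trivializationAt' p)

lemma nabla_extend_add {p : N} (v w : TangentSpace J p) :
    nabla (FiberBundle.extend E' (v + w)) p =
      nabla (FiberBundle.extend E' v) p + nabla (FiberBundle.extend E' w) p := by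
  rw [← nabla.isCovariantDerivativeOnUniv.add (mdifferentiableAt_extend v)
    (mdifferentiableAt_extend w)]
  refine nabla.isCovariantDerivativeOnUniv.congr_of_eventuallyEq (mdifferentiableAt_extend _)
    (mdifferentiableAt_add_section (mdifferentiableAt_extend v) (mdifferentiableAt_extend w))
    univ_mem ?_
  filter_upwards [eventually_mem_baseSet_self (J := J) p] with q hq
  simp only [extend_eq_symmL _ hq, map_add, Pi.add_apply]

lemma nabla_extend_smul {p : N} (c : ℝ) (v : TangentSpace J p) :
    nabla (FiberBundle.extend E' (c • v)) p = c • nabla (FiberBundle.extend E' v) p := by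
  rw [← nabla.isCovariantDerivativeOnUniv.smul_const c (mdifferentiableAt_extend v)]
  refine nabla.isCovariantDerivativeOnUniv.congr_of_eventuallyEq (mdifferentiableAt_extend _)
    ((mdifferentiableAt_extend v).smul_const_section) univ_mem ?_
  filter_upwards [eventually_mem_baseSet_self (J := J) p] with q hq
  simp only [extend_eq_symmL _ hq, map_smul, Pi.smul_apply]

lemma nabla_extend_zero (p : N) :
    nabla (FiberBundle.extend E' (0 : TangentSpace J p)) p = 0 := by
  simpa using nabla_extend_smul nabla 0 (0 : TangentSpace J p)

lemma covAlong_eq (V : (x : M) → TangentSpace J (f x)) (u : TangentSpace I x) :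
    covAlong I J nabla f V x u =
      (trivializationAt E' (TangentSpace J : N → Type _) (f x)).symmL ℝ (f x)
        (mvfderiv I (coordAlong J f V x) x u)
      + nabla (FiberBundle.extend E' (V x)) (f x) (mfderiv I J f x u) := rfl

lemma covAlong_congr {V W : (x : M) → TangentSpace J (f x)} (h : ∀ᶠ y in 𝓝 x, V y = W y) :
    covAlong I J nabla f V x = covAlong I J nabla f W x := by
  funext u
  have h1 : coordAlong J f V x =ᶠ[𝓝 x] coordAlong J f W x :=
    h.mono fun y hy ↦ by simp only [coordAlong, hy]
  rw [covAlong_eq, covAlong_eq, h.self_of_nhds]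
  rw [mvfderiv_congr h1]

lemma covAlong_zero (hf : ContinuousAt f x) : covAlong I J nabla f 0 x = 0 := by
  funext u
  have h1 : coordAlong J f 0 x =ᶠ[𝓝 x] (0 : M → E') := by
    filter_upwards [eventually_mem_baseSet (J := J) hf] with y hy
    simp [coordAlong_eq _ hy]
  simp [covAlong_eq, mvfderiv_congr h1, nabla_extend_zero]

lemma mvfderiv_coordAlong_add {V W : (x : M) → TangentSpace J (f x)}
    (hV : DiffAlongAt I J f V x) (hW : DiffAlongAt I J f W x) :
    mvfderiv I (coordAlong J f (V + W) x) x =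
      mvfderiv I (coordAlong J f V x) x + mvfderiv I (coordAlong J f W x) x := by
  rw [diffAlongAt_iff] at hV hW
  rw [← mvfderiv_add hV.2 hW.2]
  apply mvfderiv_congr
  filter_upwards [eventually_mem_baseSet (J := J) hV.1.continuousAt] with y hy
  simp [coordAlong_eq _ hy]

lemma mvfderiv_coordAlong_smul {V : (x : M) → TangentSpace J (f x)} {g : M → ℝ}
    (hg : MDifferentiableAt I 𝓘(ℝ, ℝ) g x) (hV : DiffAlongAt I J f V x) (u : TangentSpace I x) :
    mvfderiv I (coordAlong J f (fun y ↦ g y • V y) x) x u =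
      g x • mvfderiv I (coordAlong J f V x) x u + mvfderiv I g x u • coordAlong J f V x x := by
  rw [diffAlongAt_iff] at hV
  have h1 : coordAlong J f (fun y ↦ g y • V y) x =ᶠ[𝓝 x] fun y ↦ g y • coordAlong J f V x y := by
    filter_upwards [eventually_mem_baseSet (J := J) hV.1.continuousAt] with y hy
    simp [coordAlong_eq _ hy]
  rw [mvfderiv_congr h1, mvfderiv_fun_smul hg hV.2]
  rfl

lemma symmL_coordAlong_self (V : (x : M) → TangentSpace J (f x)) (x : M) :
    (trivializationAt E' (TangentSpace J : N → Type _) (f x)).symmL ℝ (f x) (coordAlong J f V x x)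
      = V x :=
  symmL_coordAlong V (FiberBundle.mem_baseSet_trivializationAt' (f x))

lemma covAlong_add_right {V W : (x : M) → TangentSpace J (f x)}
    (hV : DiffAlongAt I J f V x) (hW : DiffAlongAt I J f W x) (u : TangentSpace I x) :
    covAlong I J nabla f (V + W) x u = covAlong I J nabla f V x u + covAlong I J nabla f W x u := by
  simp only [covAlong_eq, mvfderiv_coordAlong_add hV hW, Pi.add_apply, nabla_extend_add]
  simp only [add_apply, map_add]
  abel

lemma covAlong_smul_right {V : (x : M) → TangentSpace J (f x)} {g : M → ℝ}
    (hg : MDifferentiableAt I 𝓘(ℝ, ℝ) g x) (hV : DiffAlongAt I J f V x) (u : TangentSpace I x) :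
    covAlong I J nabla f (fun y ↦ g y • V y) x u =
      g x • covAlong I J nabla f V x u + mvfderiv I g x u • V x := by
  simp only [covAlong_eq, mvfderiv_coordAlong_smul hg hV, nabla_extend_smul]
  simp only [smul_apply, map_add, map_smul, symmL_coordAlong_self]
  module

lemma covAlong_add_left (V : (x : M) → TangentSpace J (f x)) (u v : TangentSpace I x) :
    covAlong I J nabla f V x (u + v) = covAlong I J nabla f V x u + covAlong I J nabla f V x v := by
  simp only [covAlong_eq, map_add]
  abel

lemma covAlong_smul_left (V : (x : M) → TangentSpace J (f x)) (c : ℝ) (u : TangentSpace I x) :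
    covAlong I J nabla f V x (c • u) = c • covAlong I J nabla f V x u := by
  simp only [covAlong_eq, map_smul, smul_add]

lemma nabla_apply_eq [FiniteDimensional ℝ E'] {σ : (p : N) → TangentSpace J p} {p : N}
    (hσ : MDifferentiableAt J J.tangent (fun q ↦ (⟨q, σ q⟩ : TangentBundle J N)) p)
    (v : TangentSpace J p) :
    nabla σ p v = (trivializationAt E' (TangentSpace J : N → Type _) p).symmL ℝ p
        (mvfderiv J (coordAlong J (fun q ↦ q) σ p) p v)
      + nabla (FiberBundle.extend E' (σ p)) p v := by
  have key : TensorialAt J E' (fun σ : (p : N) → TangentSpace J p ↦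
      nabla σ p v - (trivializationAt E' (TangentSpace J : N → Type _) p).symmL ℝ p
        (mvfderiv J (coordAlong J (fun q ↦ q) σ p) p v)) p := by
    constructor
    · intro g σ hg hσ
      have h1 := mvfderiv_coordAlong_smul (J := J) (f := fun q ↦ q) hg hσ v
      have h2 := symmL_coordAlong_self (J := J) (f := fun q ↦ q) σ p
      have h3 : (trivializationAt E' (TangentSpace J : N → Type _) p).symmL ℝ p
        (mvfderiv J (coordAlong J (fun q ↦ q) (g • σ) p) p v) =
          (trivializationAt E' (TangentSpace J : N → Type _) p).symmL ℝ p
            (g p • mvfderiv J (coordAlong J (fun q ↦ q) σ p) p v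
              + mvfderiv J g p v • coordAlong J (fun q ↦ q) σ p p) := congrArg _ h1
      rw [nabla.isCovariantDerivativeOnUniv.leibniz hσ hg, h3, map_add, map_smul, map_smul, h2]
      simp only [add_apply, smul_apply, ContinuousLinearMap.smulRight_apply]
      module
    · intro σ τ hσ hτ
      have h1 := mvfderiv_coordAlong_add (J := J) (f := fun q ↦ q) hσ hτ
      rw [nabla.isCovariantDerivativeOnUniv.add hσ hτ, h1]
      simp only [add_apply, map_add]
      abel
  have h1 := key.pointwise hσ (mdifferentiableAt_extend (σ p))
    (FiberBundle.extend_apply_self E' (σ p)).symm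
  have h2 : coordAlong J (fun q ↦ q) (FiberBundle.extend E' (σ p)) p =ᶠ[𝓝 p] fun _ ↦
      (trivializationAt E' (TangentSpace J : N → Type _) p).continuousLinearMapAt ℝ p (σ p) := by
    filter_upwards [eventually_mem_baseSet_self (J := J) p] with q hq
    exact (coordAlong_eq (f := fun q ↦ q) _ hq).trans (continuousLinearMapAt_extend (σ p) hq)
  rw [mvfderiv_congr h2, mvfderiv_const] at h1
  simp only [zero_apply, map_zero, sub_zero] at h1
  rw [← h1]
  abel

lemma DiffAlongAt.comp {σ : (p : N) → TangentSpace J p}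
    (hσ : MDifferentiableAt J J.tangent (fun q ↦ (⟨q, σ q⟩ : TangentBundle J N)) (f x))
    (hf : MDifferentiableAt I J f x) : DiffAlongAt I J f (fun y ↦ σ (f y)) x :=
  MDifferentiableAt.comp x (f := f) (g := fun q ↦ (⟨q, σ q⟩ : TangentBundle J N)) hσ hf

lemma covAlong_comp [FiniteDimensional ℝ E'] {σ : (p : N) → TangentSpace J p}
    (hσ : MDifferentiableAt J J.tangent (fun q ↦ (⟨q, σ q⟩ : TangentBundle J N)) (f x))
    (hf : MDifferentiableAt I J f x) (u : TangentSpace I x) :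
    covAlong I J nabla f (fun y ↦ σ (f y)) x u = nabla σ (f x) (mfderiv I J f x u) := by
  rw [nabla_apply_eq nabla hσ, covAlong_eq]
  have h1 := (diffAlongAt_iff (f := fun q ↦ q).1 hσ).2
  have h2 : mvfderiv I (coordAlong J f (fun y ↦ σ (f y)) x) x u =
      mvfderiv J (coordAlong J (fun q ↦ q) σ (f x)) (f x) (mfderiv I J f x u) :=
    mfderiv_comp_apply x h1 hf u
  rw [h2]

end CovAlong

section Torsion

open Filter Topology

variable {E : Type*} [NormedAddCommGroup E] [NormedSpace ℝ E]
  {H : Type*} [TopologicalSpace H] {I : ModelWithCorners ℝ E H}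
  {M : Type*} [TopologicalSpace M] [ChartedSpace H M] [IsManifold I ∞ M]
  {E' : Type*} [NormedAddCommGroup E'] [NormedSpace ℝ E']
  {H' : Type*} [TopologicalSpace H'] {J : ModelWithCorners ℝ E' H'}
  {N : Type*} [TopologicalSpace N] [ChartedSpace H' N] [IsManifold J ∞ N]

lemma contMDiff_push {f : M → N} (hf : ContMDiff I J ∞ f) {X : (x : M) → TangentSpace I x}
    (hX : IsSmoothField I X) :
    ContMDiff I J.tangent ∞ (fun y ↦ (⟨f y, push I J f X y⟩ : TangentBundle J N)) :=
  (hf.contMDiff_tangentMap (m := ∞) (by simp)).comp hX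

lemma diffAlongAt_push {f : M → N} (hf : ContMDiff I J ∞ f) {X : (x : M) → TangentSpace I x}
    {x : M} (hX : MDifferentiableAt I I.tangent (fun y ↦ (⟨y, X y⟩ : TangentBundle I M)) x) :
    DiffAlongAt I J f (push I J f X) x :=
  ((hf.contMDiff_tangentMap (m := 1) (by norm_cast)).mdifferentiable (by simp) _).comp x hX

lemma push_add (f : M → N) (X Y : (x : M) → TangentSpace I x) :
    push I J f (X + Y) = push I J f X + push I J f Y := by
  funext y
  simp [push]

lemma push_smul (f : M → N) (g : M → ℝ) (X : (x : M) → TangentSpace I x) :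
    push I J f (g • X) = fun y ↦ g y • push I J f X y := by
  funext y
  simp [push]

lemma extend_eq_mfderivWithin {x y : M} (hy : y ∈ (chartAt H x).source) (v : TangentSpace I x) :
    FiberBundle.extend E v y =
      mfderivWithin 𝓘(ℝ, E) I (extChartAt I x).symm (Set.range I) (extChartAt I x y)
        ((trivializationAt E (TangentSpace I : M → Type _) x).continuousLinearMapAt ℝ x v) := by
  rw [extend_eq_symmL (J := I) _ (by simpa using hy), TangentBundle.symmL_trivializationAt hy]
  rfl

lemma mlieBracket_extend [CompleteSpace E] (x : M) (u v : TangentSpace I x) :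
    VectorField.mlieBracket I (FiberBundle.extend E u) (FiberBundle.extend E v) x = 0 := by
  have key (w : TangentSpace I x) : VectorField.mpullbackWithin 𝓘(ℝ, E) I (extChartAt I x).symm
      (FiberBundle.extend E w) (Set.range I) =ᶠ[𝓝[(extChartAt I x).symm ⁻¹' Set.univ ∩ Set.range I]
        (extChartAt I x x)] fun _ ↦
      (trivializationAt E (TangentSpace I : M → Type _) x).continuousLinearMapAt ℝ x w := by
    have h1 : (extChartAt I x).target ∈
        𝓝[(extChartAt I x).symm ⁻¹' Set.univ ∩ Set.range I] (extChartAt I x x) := by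
      simpa using extChartAt_target_mem_nhdsWithin x
    filter_upwards [h1] with z hz
    have h2 : (extChartAt I x).symm z ∈ (chartAt H x).source := by
      simpa using (extChartAt I x).map_target hz
    rw [VectorField.mpullbackWithin_apply, extend_eq_mfderivWithin h2,
      (extChartAt I x).right_inv hz]
    exact (isInvertible_mfderivWithin_extChartAt_symm hz).inverse_apply_eq.2 rfl
  rw [← VectorField.mlieBracketWithin_univ, VectorField.mlieBracketWithin_apply]
  have hmem : extChartAt I x x ∈ (extChartAt I x).symm ⁻¹' Set.univ ∩ Set.range I := by simp
  have h : VectorField.lieBracketWithin ℝ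
      (VectorField.mpullbackWithin 𝓘(ℝ, E) I (extChartAt I x).symm
        (FiberBundle.extend E u) (Set.range I))
      (VectorField.mpullbackWithin 𝓘(ℝ, E) I (extChartAt I x).symm
        (FiberBundle.extend E v) (Set.range I))
      ((extChartAt I x).symm ⁻¹' Set.univ ∩ Set.range I) (extChartAt I x x) = (0 : E) := by
    refine (Filter.EventuallyEq.lieBracketWithin_vectorField_eq_of_mem (𝕜 := ℝ) (E := E)
      (key u) (key v) hmem).trans ?_
    rw [VectorField.lieBracketWithin, fderivWithin_const_apply, fderivWithin_const_apply]
    simp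
  exact (congrArg _ h).trans (map_zero _)

lemma mvfderiv_coordAlong_push_extend [I.Boundaryless] {f : M → N} (hf : ContMDiff I J ∞ f) (x : M)
    (u v : TangentSpace I x) :
    mvfderiv I (coordAlong J f (push I J f (FiberBundle.extend E v)) x) x u =
      fderiv ℝ (fderiv ℝ (extChartAt J (f x) ∘ f ∘ (extChartAt I x).symm)) (extChartAt I x x)
        ((trivializationAt E (TangentSpace I : M → Type _) x).continuousLinearMapAt ℝ x u)
        ((trivializationAt E (TangentSpace I : M → Type _) x).continuousLinearMapAt ℝ x v) := by
  set F : E → E' := extChartAt J (f x) ∘ f ∘ (extChartAt I x).symm with hF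
  set w : E := (trivializationAt E (TangentSpace I : M → Type _) x).continuousLinearMapAt ℝ x v
    with hw
  have hsmooth : ContDiffAt ℝ ∞ F (extChartAt I x x) := by
    have := (contMDiffAt_iff.1 (hf x)).2
    rwa [I.range_eq_univ, contDiffWithinAt_univ] at this
  have h1 : coordAlong J f (push I J f (FiberBundle.extend E v)) x =ᶠ[𝓝 x]
      (fun z ↦ fderiv ℝ F z w) ∘ extChartAt I x := by
    filter_upwards [eventually_mem_baseSet (J := J) hf.continuous.continuousAt,
      chart_source_mem_nhds H x] with y hy hyx
    have hy' : f y ∈ (chartAt H' (f x)).source := by simpa using hy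
    rw [coordAlong_eq _ hy, TangentBundle.continuousLinearMapAt_trivializationAt hy', push,
      extend_eq_mfderivWithin hyx, I.range_eq_univ, mfderivWithin_univ]
    have e1 : (extChartAt I x).symm (extChartAt I x y) = y :=
      (extChartAt I x).left_inv (by simpa using hyx)
    have e2 : MDifferentiableAt 𝓘(ℝ, E) I (extChartAt I x).symm (extChartAt I x y) := by
      have := mdifferentiableWithinAt_extChartAt_symm (I := I)
        ((extChartAt I x).map_source (by simpa using hyx : y ∈ (extChartAt I x).source))
      rwa [I.range_eq_univ, mdifferentiableWithinAt_univ] at this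
    have e3 : MDifferentiableAt I J f ((extChartAt I x).symm (extChartAt I x y)) :=
      hf.mdifferentiable (by simp) _
    have e4 : MDifferentiableAt J 𝓘(ℝ, E') (extChartAt J (f x))
        (f ((extChartAt I x).symm (extChartAt I x y))) := by
      rw [e1]
      exact mdifferentiableAt_extChartAt hy'
    have e5 : fderiv ℝ F (extChartAt I x y) w =
        mfderiv J 𝓘(ℝ, E') (extChartAt J (f x)) (f ((extChartAt I x).symm (extChartAt I x y)))
          (mfderiv I J f ((extChartAt I x).symm (extChartAt I x y))
            (mfderiv 𝓘(ℝ, E) I (extChartAt I x).symm (extChartAt I x y) w)) := by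
      have h1 := mfderiv_comp_apply (extChartAt I x y) e4 (e3.comp _ e2) w
      have h2 := mfderiv_comp_apply (extChartAt I x y) e3 e2 w
      rw [h2] at h1
      rw [← mfderiv_eq_fderiv]
      exact h1
    rw [Function.comp_apply, e5, e1]
    rfl
  have hd : DifferentiableAt ℝ (fderiv ℝ F) (extChartAt I x x) :=
    (hsmooth.fderiv_right (m := 1) (by norm_cast)).differentiableAt (by simp)
  rw [mvfderiv_congr h1]
  have h2 : MDifferentiableAt I 𝓘(ℝ, E) (extChartAt I x) x := mdifferentiableAt_extChartAt (by simp)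
  have h3 : HasFDerivAt (fun z ↦ fderiv ℝ F z w)
      ((ContinuousLinearMap.apply ℝ E' w).comp (fderiv ℝ (fderiv ℝ F) (extChartAt I x x)))
      (extChartAt I x x) :=
    (ContinuousLinearMap.apply ℝ E' w).hasFDerivAt.comp _ hd.hasFDerivAt
  have h4 : mvfderiv I ((fun z ↦ fderiv ℝ F z w) ∘ extChartAt I x) x u =
      mfderiv 𝓘(ℝ, E) 𝓘(ℝ, E') (fun z ↦ fderiv ℝ F z w) (extChartAt I x x)
        (mfderiv I 𝓘(ℝ, E) (extChartAt I x) x u) :=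
    mfderiv_comp_apply x h3.differentiableAt.mdifferentiableAt h2 u
  rw [h4, mfderiv_eq_fderiv, h3.fderiv, TangentBundle.continuousLinearMapAt_trivializationAt (by simp)]
  rfl

lemma fderiv_fderiv_symm [I.Boundaryless] {f : M → N} (hf : ContMDiff I J ∞ f) (x : M) (u v : E) :
    fderiv ℝ (fderiv ℝ (extChartAt J (f x) ∘ f ∘ (extChartAt I x).symm)) (extChartAt I x x) u v =
    fderiv ℝ (fderiv ℝ (extChartAt J (f x) ∘ f ∘ (extChartAt I x).symm)) (extChartAt I x x) v u := by
  have hsmooth : ContDiffAt ℝ ∞ (extChartAt J (f x) ∘ f ∘ (extChartAt I x).symm)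
      (extChartAt I x x) := by
    have := (contMDiffAt_iff.1 (hf x)).2
    rwa [I.range_eq_univ, contDiffWithinAt_univ] at this
  exact hsmooth.isSymmSndFDerivAt (by simp; norm_cast) u v

variable [I.Boundaryless] [CompleteSpace E] [FiniteDimensional ℝ E] [CompleteSpace E']
  [FiniteDimensional ℝ E']
  (nabla : CovariantDerivative J E' (fun p : N ↦ TangentSpace J p))

lemma covAlong_push_extend_sub (htor : nabla.torsion = 0) {f : M → N} (hf : ContMDiff I J ∞ f)
    (x : M) (u v : TangentSpace I x) :
    covAlong I J nabla f (push I J f (FiberBundle.extend E v)) x u =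
      covAlong I J nabla f (push I J f (FiberBundle.extend E u)) x v := by
  have h := nabla.torsion_eq_zero_iff.1 htor (mdifferentiableAt_extend (mfderiv I J f x u))
    (mdifferentiableAt_extend (mfderiv I J f x v))
  rw [mlieBracket_extend, FiberBundle.extend_apply_self, FiberBundle.extend_apply_self,
    sub_eq_zero] at h
  rw [covAlong_eq, covAlong_eq, mvfderiv_coordAlong_push_extend hf,
    mvfderiv_coordAlong_push_extend hf, fderiv_fderiv_symm hf]
  simp only [push, FiberBundle.extend_apply_self, h]

lemma covAlong_push_sub (htor : nabla.torsion = 0) {f : M → N} (hf : ContMDiff I J ∞ f)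
    {X Y : (x : M) → TangentSpace I x} {x : M}
    (hX : MDifferentiableAt I I.tangent (fun y ↦ (⟨y, X y⟩ : TangentBundle I M)) x)
    (hY : MDifferentiableAt I I.tangent (fun y ↦ (⟨y, Y y⟩ : TangentBundle I M)) x) :
    covAlong I J nabla f (push I J f Y) x (X x) - covAlong I J nabla f (push I J f X) x (Y x) =
      mfderiv I J f x (VectorField.mlieBracket I X Y x) := by
  set Φ : ((x : M) → TangentSpace I x) → ((x : M) → TangentSpace I x) → TangentSpace J (f x) :=
    fun X Y ↦ covAlong I J nabla f (push I J f Y) x (X x)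
      - covAlong I J nabla f (push I J f X) x (Y x)
      - mfderiv I J f x (VectorField.mlieBracket I X Y x) with hΦ
  have hanti (X Y) : Φ X Y = - Φ Y X := by
    simp only [hΦ, VectorField.mlieBracket_swap_apply (V := X), map_neg]
    abel
  have hten (Y : (x : M) → TangentSpace I x)
      (hY : MDifferentiableAt I I.tangent (fun y ↦ (⟨y, Y y⟩ : TangentBundle I M)) x) :
      TensorialAt I E (fun X ↦ Φ X Y) x := by
    constructor
    · intro g X hg hX
      simp only [hΦ]
      rw [push_smul, covAlong_smul_right nabla hg (diffAlongAt_push hf hX),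
        VectorField.mlieBracket_smul_left hg hX, Pi.smul_apply', covAlong_smul_left]
      simp only [map_add, map_smul, push]
      module
    · intro X X' hX hX'
      simp only [hΦ]
      rw [push_add, covAlong_add_right nabla (diffAlongAt_push hf hX) (diffAlongAt_push hf hX'),
        VectorField.mlieBracket_add_left hX hX', Pi.add_apply, covAlong_add_left]
      simp only [map_add]
      abel
  have h1 : Φ X Y = Φ (FiberBundle.extend E (X x)) (FiberBundle.extend E (Y x)) := by
    rw [(hten Y hY).pointwise hX (mdifferentiableAt_extend (X x))
      (FiberBundle.extend_apply_self E (X x)).symm, hanti,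
      (hten _ (mdifferentiableAt_extend (X x))).pointwise hY (mdifferentiableAt_extend (Y x))
      (FiberBundle.extend_apply_self E (Y x)).symm, ← hanti]
  have h2 : Φ (FiberBundle.extend E (X x)) (FiberBundle.extend E (Y x)) = 0 := by
    simp only [hΦ, mlieBracket_extend, FiberBundle.extend_apply_self, map_zero, sub_zero]
    rw [covAlong_push_extend_sub nabla htor hf, sub_self]
  exact sub_eq_zero.1 (h1.trans h2)

end Torsion

section SecondFundamentalForm

variable {E : Type*} [NormedAddCommGroup E] [NormedSpace ℝ E]
  {H : Type*} [TopologicalSpace H] {I : ModelWithCorners ℝ E H}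
  {M : Type*} [TopologicalSpace M] [ChartedSpace H M]
  {E' : Type*} [NormedAddCommGroup E'] [NormedSpace ℝ E']
  {H' : Type*} [TopologicalSpace H'] {J : ModelWithCorners ℝ E' H'}
  {N : Type*} [TopologicalSpace N] [ChartedSpace H' N] [IsManifold J ∞ N]
  [FiniteDimensional ℝ E] [FiniteDimensional ℝ E']
  [RiemannianBundle (fun p : N ↦ TangentSpace J p)] {f : M → N} {x : M}

lemma mfderiv_mem_tangentRange (u : TangentSpace I x) :
    mfderiv I J f x u ∈ tangentRange I J f x := ⟨u, rfl⟩

lemma mfderiv_tangentPart (w : TangentSpace J (f x)) :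
    mfderiv I J f x (tangentPart I J f x w) = (tangentRange I J f x).starProjection w := by
  obtain ⟨v, hv⟩ : (tangentRange I J f x).starProjection w ∈ tangentRange I J f x :=
    Submodule.starProjection_apply_mem _ w
  exact Function.invFun_eq ⟨v, hv⟩

lemma mfderiv_tangentPart_of_mem {w : TangentSpace J (f x)} (hw : w ∈ tangentRange I J f x) :
    mfderiv I J f x (tangentPart I J f x w) = w := by
  rw [mfderiv_tangentPart, Submodule.starProjection_eq_self_iff.2 hw]

lemma normalPart_add (w w' : TangentSpace J (f x)) :
    normalPart I J f x (w + w') = normalPart I J f x w + normalPart I J f x w' := by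
  simp only [normalPart, map_add]
  abel

lemma normalPart_smul (c : ℝ) (w : TangentSpace J (f x)) :
    normalPart I J f x (c • w) = c • normalPart I J f x w := by
  simp only [normalPart, map_smul, smul_sub]

lemma normalPart_of_mem {w : TangentSpace J (f x)} (hw : w ∈ tangentRange I J f x) :
    normalPart I J f x w = 0 := by
  rw [normalPart, Submodule.starProjection_eq_self_iff.2 hw, sub_self]

lemma normalPart_zero : normalPart I J f x 0 = 0 := normalPart_of_mem (Submodule.zero_mem _)

lemma secondFundForm_add_left (nabla : CovariantDerivative J E' (fun p : N ↦ TangentSpace J p)) [IsManifold I ∞ M]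
    (u u' v : TangentSpace I x) :
    secondFundForm I J nabla f x (u + u') v =
      secondFundForm I J nabla f x u v + secondFundForm I J nabla f x u' v := by
  rw [secondFundForm, covAlong_add_left, normalPart_add]
  rfl

lemma secondFundForm_smul_left (nabla : CovariantDerivative J E' (fun p : N ↦ TangentSpace J p)) [IsManifold I ∞ M]
    (c : ℝ) (u v : TangentSpace I x) :
    secondFundForm I J nabla f x (c • u) v = c • secondFundForm I J nabla f x u v := by
  rw [secondFundForm, covAlong_smul_left, normalPart_smul]
  rfl

variable [IsManifold I ∞ M]
  (nabla : CovariantDerivative J E' (fun p : N ↦ TangentSpace J p))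

lemma normalPart_covAlong_push (hf : ContMDiff I J ∞ f) {X : (x : M) → TangentSpace I x}
    (hX : MDifferentiableAt I I.tangent (fun y ↦ (⟨y, X y⟩ : TangentBundle I M)) x)
    (u : TangentSpace I x) :
    normalPart I J f x (covAlong I J nabla f (push I J f X) x u) =
      secondFundForm I J nabla f x u (X x) := by
  have hten : TensorialAt I E (fun X : (x : M) → TangentSpace I x ↦
      normalPart I J f x (covAlong I J nabla f (push I J f X) x u)) x := by
    constructor
    · intro g X hg hX
      rw [push_smul, covAlong_smul_right nabla hg (diffAlongAt_push hf hX), normalPart_add,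
        normalPart_smul, normalPart_smul, push, normalPart_of_mem (mfderiv_mem_tangentRange _),
        smul_zero, add_zero]
    · intro X Y hX hY
      rw [push_add, covAlong_add_right nabla (diffAlongAt_push hf hX) (diffAlongAt_push hf hY),
        normalPart_add]
  exact hten.pointwise hX (mdifferentiableAt_extend (X x))
    (FiberBundle.extend_apply_self E (X x)).symm

variable [I.Boundaryless] [CompleteSpace E] [CompleteSpace E']

lemma secondFundForm_symm (htor : nabla.torsion = 0) (hf : ContMDiff I J ∞ f)
    (u v : TangentSpace I x) :
    secondFundForm I J nabla f x u v = secondFundForm I J nabla f x v u := by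
  rw [secondFundForm, secondFundForm, covAlong_push_extend_sub nabla htor hf]

lemma secondFundForm_add_right (htor : nabla.torsion = 0) (hf : ContMDiff I J ∞ f)
    (u v v' : TangentSpace I x) :
    secondFundForm I J nabla f x u (v + v') =
      secondFundForm I J nabla f x u v + secondFundForm I J nabla f x u v' := by
  rw [secondFundForm_symm nabla htor hf, secondFundForm_add_left,
    secondFundForm_symm nabla htor hf v, secondFundForm_symm nabla htor hf v']

lemma secondFundForm_smul_right (htor : nabla.torsion = 0) (hf : ContMDiff I J ∞ f)
    (c : ℝ) (u v : TangentSpace I x) :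
    secondFundForm I J nabla f x u (c • v) = c • secondFundForm I J nabla f x u v := by
  rw [secondFundForm_symm nabla htor hf, secondFundForm_smul_left,
    secondFundForm_symm nabla htor hf v]

end SecondFundamentalForm

section SmoothFields

open Filter Topology

variable {E : Type*} [NormedAddCommGroup E] [NormedSpace ℝ E] [FiniteDimensional ℝ E]
  {H : Type*} [TopologicalSpace H] {I : ModelWithCorners ℝ E H}
  {M : Type*} [TopologicalSpace M] [ChartedSpace H M] [IsManifold I ∞ M]

lemma IsSmoothField.mdifferentiableAt {X : (x : M) → TangentSpace I x} (hX : IsSmoothField I X)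
    (x : M) : MDifferentiableAt I I.tangent (fun y ↦ (⟨y, X y⟩ : TangentBundle I M)) x :=
  ContMDiff.mdifferentiable hX (by simp) x

/-- Every tangent vector extends to a smooth vector field which agrees with the extension with
constant components near the base point. -/
lemma exists_smoothField_extend [T2Space M] {x : M} (v : TangentSpace I x) :
    ∃ X : (x : M) → TangentSpace I x, IsSmoothField I X ∧ X x = v ∧
      ∀ᶠ y in 𝓝 x, X y = FiberBundle.extend E v y := by
  obtain ⟨s, hs, hsm⟩ := FiberBundle.exists_contMDiffOn_extend (k := ∞) I E v
  obtain ⟨b, -, hb⟩ := (SmoothBumpFunction.nhds_basis_tsupport (I := I) x).mem_iff.1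
    (interior_mem_nhds.2 hs)
  refine ⟨fun y ↦ b y • FiberBundle.extend E v y, ?_, ?_, ?_⟩
  · exact ContMDiffOn.smul_section_of_tsupport (V := (TangentSpace I : M → Type _))
      b.contMDiff.contMDiffOn isOpen_interior hb (hsm.mono interior_subset)
  · simp
  · filter_upwards [b.eventuallyEq_one] with y hy
    simp [hy]

variable {E' : Type*} [NormedAddCommGroup E'] [NormedSpace ℝ E'] [FiniteDimensional ℝ E']
  [CompleteSpace E]
  {H' : Type*} [TopologicalSpace H'] {J : ModelWithCorners ℝ E' H'}
  {N : Type*} [TopologicalSpace N] [ChartedSpace H' N] [IsManifold J ∞ N]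

lemma exists_leftInverse_clm (A : E →L[ℝ] E') (hA : Function.Injective A) :
    ∃ P : E' →L[ℝ] E, P.comp A = 1 := by
  obtain ⟨P, hP⟩ := (A : E →ₗ[ℝ] E').exists_leftInverse_of_injective (LinearMap.ker_eq_bot.2 hA)
  refine ⟨LinearMap.toContinuousLinearMap P, ?_⟩
  ext v
  exact LinearMap.congr_fun hP v

/-- A vector field whose image under an immersion is smooth along the immersion is smooth. -/
lemma isSmoothField_of_push {f : M → N} (hf : IsSmoothImmersion I J f)
    {X : (x : M) → TangentSpace I x}
    (hX : ContMDiff I J.tangent ∞ (fun y ↦ (⟨f y, push I J f X y⟩ : TangentBundle J N))) :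
    IsSmoothField I X := by
  intro x
  rw [contMDiffAt_section]
  set A : M → E →L[ℝ] E' := inTangentCoordinates I J id f (mfderiv I J f) x with hA
  have hAs : ContMDiffAt I 𝓘(ℝ, E →L[ℝ] E') ∞ A x :=
    ContMDiffAt.mfderiv_const (hf.1 x) (by simp)
  have hw := (contMDiffAt_totalSpace.1 (hX x)).2
  have hbx : ∀ᶠ y in 𝓝 x, y ∈ (trivializationAt E (TangentSpace I : M → Type _) x).baseSet :=
    eventually_mem_baseSet_self (J := I) x
  have hby := eventually_mem_baseSet (J := J) (hf.1.continuous.continuousAt (x := x))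
  have hAv (y : M) (hy : y ∈ (trivializationAt E (TangentSpace I : M → Type _) x).baseSet)
      (hy' : f y ∈ (trivializationAt E' (TangentSpace J : N → Type _) (f x)).baseSet) :
      A y (coordAlong I (fun z ↦ z) X x y) = coordAlong J f (push I J f X) x y := by
    have h1 : coordAlong I (fun z ↦ z) X x y =
      (trivializationAt E (TangentSpace I : M → Type _) x).continuousLinearMapAt ℝ y (X y) :=
      coordAlong_eq (f := fun z ↦ z) X hy
    have h2 := Trivialization.symmL_continuousLinearMapAt (R := ℝ) _ hy (X y)
    rw [h1, coordAlong_eq _ hy', push]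
    change (trivializationAt E' (TangentSpace J : N → Type _) (f x)).continuousLinearMapAt ℝ (f y)
      (mfderiv I J f y ((trivializationAt E (TangentSpace I : M → Type _) x).symmL ℝ y _)) = _
    rw [h2]
  have hinj : Function.Injective (A x) := by
    intro v v' h
    have h1 := congrArg
      ((trivializationAt E' (TangentSpace J : N → Type _) (f x)).symmL ℝ (f x)) h
    have h2 : mfderiv I J f x ((trivializationAt E (TangentSpace I : M → Type _) x).symmL ℝ x v) =
        mfderiv I J f x ((trivializationAt E (TangentSpace I : M → Type _) x).symmL ℝ x v') := by
      rw [← Trivialization.symmL_continuousLinearMapAt (R := ℝ) _ hby.self_of_nhds (mfderiv I J f x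
        ((trivializationAt E (TangentSpace I : M → Type _) x).symmL ℝ x v)),
        ← Trivialization.symmL_continuousLinearMapAt (R := ℝ) _ hby.self_of_nhds (mfderiv I J f x
        ((trivializationAt E (TangentSpace I : M → Type _) x).symmL ℝ x v'))]
      exact h1
    rw [← Trivialization.continuousLinearMapAt_symmL (R := ℝ) _ hbx.self_of_nhds v, hf.2 x h2,
      Trivialization.continuousLinearMapAt_symmL _ hbx.self_of_nhds]
  obtain ⟨P, hP⟩ := exists_leftInverse_clm (A x) hinj
  have hB : ContMDiffAt I 𝓘(ℝ, E →L[ℝ] E) ∞ (fun y ↦ P.comp (A y)) x :=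
    contMDiffAt_const.clm_comp hAs
  have hBx : P.comp (A x) = ((1 : (E →L[ℝ] E)ˣ) : E →L[ℝ] E) := hP
  have hinv : ContMDiffAt I 𝓘(ℝ, E →L[ℝ] E) ∞ (fun y ↦ Ring.inverse (P.comp (A y))) x := by
    refine ContMDiffAt.comp x (I' := 𝓘(ℝ, E →L[ℝ] E)) (g := Ring.inverse)
      (f := fun y ↦ P.comp (A y)) ?_ hB
    rw [hBx]
    exact (contDiffAt_ringInverse ℝ 1).contMDiffAt
  have hunit : ∀ᶠ y in 𝓝 x, IsUnit (P.comp (A y)) := by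
    refine hB.continuousAt.eventually_mem (Units.isOpen.mem_nhds ?_)
    rw [hBx]
    exact Units.isUnit _
  refine (hinv.clm_apply (contMDiffAt_const.clm_apply hw)
    : ContMDiffAt I 𝓘(ℝ, E) ∞ (fun y ↦ Ring.inverse (P.comp (A y)) (P _)) x).congr_of_eventuallyEq ?_
  filter_upwards [hbx, hby, hunit] with y hy hy' hyu
  have h1 := hAv y hy hy'
  have h2 : (Ring.inverse (P.comp (A y)) * P.comp (A y)) (coordAlong I (fun z ↦ z) X x y) =
      coordAlong I (fun z ↦ z) X x y := by
    rw [Ring.inverse_mul_cancel _ hyu]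
    rfl
  rw [mul_apply_eq_comp, ContinuousLinearMap.comp_apply, h1] at h2
  exact h2.symm

end SmoothFields

section Ambient

open Filter Topology

variable {E' : Type*} [NormedAddCommGroup E'] [NormedSpace ℝ E'] [FiniteDimensional ℝ E']
  [CompleteSpace E']
  {H' : Type*} [TopologicalSpace H'] {J : ModelWithCorners ℝ E' H'}
  {N : Type*} [TopologicalSpace N] [ChartedSpace H' N] [IsManifold J ∞ N]
  [RiemannianBundle (fun p : N ↦ TangentSpace J p)]
  [IsContMDiffRiemannianBundle J ∞ E' (fun p : N ↦ TangentSpace J p)]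
  {nabla : CovariantDerivative J E' (fun p : N ↦ TangentSpace J p)}
  (S : AlmostContactMetric J N) {β : N → ℝ}

lemma AlmostContactMetric.isSmoothField_φ {Z : (p : N) → TangentSpace J p}
    (hZ : IsSmoothField J Z) : IsSmoothField J (fun q ↦ S.φ q (Z q)) :=
  ContMDiff.clm_bundle_apply S.smooth_φ hZ

lemma AlmostContactMetric.mdifferentiableAt_φ {Z : (p : N) → TangentSpace J p} {p : N}
    (hZ : MDifferentiableAt J J.tangent (fun q ↦ (⟨q, Z q⟩ : TangentBundle J N)) p) :
    MDifferentiableAt J J.tangent (fun q ↦ (⟨q, S.φ q (Z q)⟩ : TangentBundle J N)) p :=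
  MDifferentiableAt.clm_bundle_apply (S.smooth_φ.mdifferentiable (by simp) p) hZ

variable {S}

lemma nabla_ξ_φ_of_isSmoothField [T2Space N] (hnabla : IsLeviCivita J N nabla)
    (hS : IsSQSasakian S nabla β) {Z : (p : N) → TangentSpace J p} (hZ : IsSmoothField J Z)
    (p : N) :
    nabla (fun q ↦ S.φ q (Z q)) p (S.ξ p) = S.φ p (nabla Z p (S.ξ p)) := by
  refine ext_inner_left ℝ fun y ↦ ?_
  obtain ⟨Y, hY, rfl, -⟩ := exists_smoothField_extend y
  have hd := hS.closed S.ξ Y Z S.smooth_ξ hY hZ p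
  have h1 := nabla.torsion_eq_zero_iff.1 hnabla.1 (S.smooth_ξ.mdifferentiableAt p) (hY.mdifferentiableAt p)
  have h2 := nabla.torsion_eq_zero_iff.1 hnabla.1 (hZ.mdifferentiableAt p)
    (S.smooth_ξ.mdifferentiableAt p)
  have h3 := hnabla.2 Y _ p (hY.mdifferentiableAt p)
    ((S.isSmoothField_φ hZ).mdifferentiableAt p) (S.ξ p)
  have e1 : (fun q ↦ S.fundamentalForm q (Z q) (S.ξ q)) = fun _ ↦ 0 := by
    funext q
    rw [AlmostContactMetric.fundamentalForm, S.φ_ξ, inner_zero_right]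
  have e2 : (fun q ↦ S.fundamentalForm q (S.ξ q) (Y q)) = fun _ ↦ 0 := by
    funext q
    rw [AlmostContactMetric.fundamentalForm, real_inner_comm, S.inner_ξ, S.η_φ]
  simp only [extDerivTwo, lieDerivFun, e1, e2, mvfderiv_const, ← h1, ← h2, hS.nabla_ξ] at hd
  simp only [AlmostContactMetric.fundamentalForm, S.φ_ξ, inner_zero_right, h3, zero_apply,
    inner_sub_left, inner_neg_left, inner_smul_left] at hd
  have e3 := real_inner_comm (S.φ p (Y p)) (S.φ p (Z p))
  have e4 := S.inner_φ p (nabla Z p (S.ξ p)) (Y p)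
  rw [real_inner_comm] at e4
  rw [e4]
  simp only [e3, conj_trivial] at hd
  linarith

lemma nabla_ξ_φ [T2Space N] (hnabla : IsLeviCivita J N nabla)
    (hS : IsSQSasakian S nabla β) {Z : (p : N) → TangentSpace J p} {p : N}
    (hZ : MDifferentiableAt J J.tangent (fun q ↦ (⟨q, Z q⟩ : TangentBundle J N)) p) :
    nabla (fun q ↦ S.φ q (Z q)) p (S.ξ p) = S.φ p (nabla Z p (S.ξ p)) := by
  have hten : TensorialAt J E' (fun Z : (p : N) → TangentSpace J p ↦
      nabla (fun q ↦ S.φ q (Z q)) p (S.ξ p) - S.φ p (nabla Z p (S.ξ p))) p := by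
    constructor
    · intro g Z hg hZ
      have h1 : (fun q ↦ S.φ q ((g • Z) q)) = g • fun q ↦ S.φ q (Z q) := by
        funext q
        simp
      rw [h1, nabla.isCovariantDerivativeOnUniv.leibniz (S.mdifferentiableAt_φ hZ) hg,
        nabla.isCovariantDerivativeOnUniv.leibniz hZ hg]
      simp only [add_apply, smul_apply, ContinuousLinearMap.smulRight_apply, map_add, map_smul]
      module
    · intro Z Z' hZ hZ'
      have h1 : (fun q ↦ S.φ q ((Z + Z') q)) = (fun q ↦ S.φ q (Z q)) + fun q ↦ S.φ q (Z' q) := by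
        funext q
        simp
      rw [h1, nabla.isCovariantDerivativeOnUniv.add (S.mdifferentiableAt_φ hZ)
        (S.mdifferentiableAt_φ hZ'), nabla.isCovariantDerivativeOnUniv.add hZ hZ']
      simp only [add_apply, map_add]
      abel
  obtain ⟨Y, hY, hYp, -⟩ := exists_smoothField_extend (Z p)
  have h := hten.pointwise hZ (hY.mdifferentiableAt p) hYp.symm
  simp only [nabla_ξ_φ_of_isSmoothField hnabla hS hY, sub_self] at h
  exact sub_eq_zero.1 h

end Ambient

section Along

open Filter Topology

variable {E : Type*} [NormedAddCommGroup E] [NormedSpace ℝ E]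
  {H : Type*} [TopologicalSpace H] {I : ModelWithCorners ℝ E H}
  {M : Type*} [TopologicalSpace M] [ChartedSpace H M]
  {E' : Type*} [NormedAddCommGroup E'] [NormedSpace ℝ E'] [FiniteDimensional ℝ E']
  [CompleteSpace E']
  {H' : Type*} [TopologicalSpace H'] {J : ModelWithCorners ℝ E' H'}
  {N : Type*} [TopologicalSpace N] [ChartedSpace H' N] [IsManifold J ∞ N]
  {f : M → N} {x : M} (nabla : CovariantDerivative J E' (fun p : N ↦ TangentSpace J p))

lemma DiffAlongAt.add {V W : (x : M) → TangentSpace J (f x)}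
    (hV : DiffAlongAt I J f V x) (hW : DiffAlongAt I J f W x) :
    DiffAlongAt I J f (V + W) x := by
  rw [diffAlongAt_iff] at *
  refine ⟨hV.1, (hV.2.add hW.2).congr_of_eventuallyEq ?_⟩
  filter_upwards [eventually_mem_baseSet (J := J) hV.1.continuousAt] with y hy
  simp [coordAlong_eq _ hy]

lemma DiffAlongAt.smul {V : (x : M) → TangentSpace J (f x)} {g : M → ℝ}
    (hg : MDifferentiableAt I 𝓘(ℝ, ℝ) g x) (hV : DiffAlongAt I J f V x) :
    DiffAlongAt I J f (fun y ↦ g y • V y) x := by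
  rw [diffAlongAt_iff] at *
  refine ⟨hV.1, (hg.smul hV.2).congr_of_eventuallyEq ?_⟩
  filter_upwards [eventually_mem_baseSet (J := J) hV.1.continuousAt] with y hy
  simp [coordAlong_eq _ hy]

lemma diffAlongAt_zero (hf : MDifferentiableAt I J f x) : DiffAlongAt I J f 0 x := by
  rw [diffAlongAt_iff]
  refine ⟨hf, (mdifferentiableAt_const (c := (0 : E'))).congr_of_eventuallyEq ?_⟩
  filter_upwards [eventually_mem_baseSet (J := J) hf.continuousAt] with y hy
  simp [coordAlong_eq _ hy]

lemma covAlong_sum {ι : Type*} (s : Finset ι) {V : ι → (x : M) → TangentSpace J (f x)}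
    (hf : MDifferentiableAt I J f x) (hV : ∀ i, DiffAlongAt I J f (V i) x) (u : TangentSpace I x) :
    DiffAlongAt I J f (∑ i ∈ s, V i) x ∧
    covAlong I J nabla f (∑ i ∈ s, V i) x u = ∑ i ∈ s, covAlong I J nabla f (V i) x u := by
  classical
  induction s using Finset.induction_on with
  | empty =>
    simp only [Finset.sum_empty]
    exact ⟨diffAlongAt_zero hf, by rw [covAlong_zero nabla hf.continuousAt]; rfl⟩
  | insert a s ha ih =>
    simp only [Finset.sum_insert ha]
    exact ⟨(hV a).add ih.1, by rw [covAlong_add_right nabla (hV a) ih.1, ih.2]⟩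

/-- A vector field along `f` is a combination of restrictions of vector fields on the target. -/
lemma exists_eventually_eq_sum {V : (x : M) → TangentSpace J (f x)} (hV : DiffAlongAt I J f V x) :
    ∃ (ι : Type) (_ : Fintype ι) (c : ι → M → ℝ) (e : ι → TangentSpace J (f x)),
      (∀ i, MDifferentiableAt I 𝓘(ℝ, ℝ) (c i) x) ∧
      ∀ᶠ y in 𝓝 x, V y = ∑ i, c i y • FiberBundle.extend E' (e i) (f y) := by
  obtain ⟨hf, hc⟩ := diffAlongAt_iff.1 hV
  set b := Module.finBasis ℝ E'
  set t := trivializationAt E' (TangentSpace J : N → Type _) (f x)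
  refine ⟨Fin (Module.finrank ℝ E'), inferInstance, fun i y ↦ b.coord i (coordAlong J f V x y),
    fun i ↦ t.symmL ℝ (f x) (b i), fun i ↦ ?_, ?_⟩
  · exact ((LinearMap.toContinuousLinearMap (b.coord i)).mdifferentiableAt).comp x hc
  · filter_upwards [eventually_mem_baseSet (J := J) hf.continuousAt] with y hy
    rw [← symmL_coordAlong V hy]
    conv_lhs => rw [← b.sum_repr (coordAlong J f V x y)]
    rw [map_sum]
    refine Finset.sum_congr rfl fun i _ ↦ ?_
    rw [extend_eq_symmL _ hy, Trivialization.continuousLinearMapAt_symmL _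
      (FiberBundle.mem_baseSet_trivializationAt' (f x)), map_smul]
    rfl

variable [RiemannianBundle (fun p : N ↦ TangentSpace J p)]
  [IsContMDiffRiemannianBundle J ∞ E' (fun p : N ↦ TangentSpace J p)]
  {nabla} {S : AlmostContactMetric J N} {β : N → ℝ}

lemma DiffAlongAt.φ (S : AlmostContactMetric J N) {V : (x : M) → TangentSpace J (f x)}
    (hV : DiffAlongAt I J f V x) :
    DiffAlongAt I J f (fun y ↦ S.φ (f y) (V y)) x :=
  MDifferentiableAt.clm_bundle_apply
    ((S.smooth_φ.mdifferentiable (by simp) (f x)).comp x (diffAlongAt_iff.1 hV).1) hV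

lemma covAlong_φ_of_mfderiv_eq_ξ [T2Space N] (hnabla : IsLeviCivita J N nabla)
    (hS : IsSQSasakian S nabla β) {V : (x : M) → TangentSpace J (f x)}
    (hV : DiffAlongAt I J f V x) {u : TangentSpace I x} (hu : mfderiv I J f x u = S.ξ (f x)) :
    covAlong I J nabla f (fun y ↦ S.φ (f y) (V y)) x u =
      S.φ (f x) (covAlong I J nabla f V x u) := by
  have hf := (diffAlongAt_iff.1 hV).1
  obtain ⟨ι, _, c, e, hc, hVe⟩ := exists_eventually_eq_sum hV
  have he (i : ι) := mdifferentiableAt_extend (J := J) (e i)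
  have h1 : ∀ᶠ y in 𝓝 x, V y =
      (∑ i, fun y ↦ c i y • FiberBundle.extend E' (e i) (f y) : (y : M) → TangentSpace J (f y)) y := by
    filter_upwards [hVe] with y hy
    rw [hy, Finset.sum_apply]
  have h2 : ∀ᶠ y in 𝓝 x, S.φ (f y) (V y) =
      (∑ i, fun y ↦ c i y • S.φ (f y) (FiberBundle.extend E' (e i) (f y)) :
        (y : M) → TangentSpace J (f y)) y := by
    filter_upwards [hVe] with y hy
    rw [hy, Finset.sum_apply, map_sum]
    simp only [map_smul]
  have h3 (i : ι) : DiffAlongAt I J f (fun y ↦ FiberBundle.extend E' (e i) (f y)) x :=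
    DiffAlongAt.comp (he i) hf
  rw [covAlong_congr nabla h1, covAlong_congr nabla h2,
    (covAlong_sum nabla _ hf (fun i ↦ (h3 i).smul (hc i)) u).2,
    (covAlong_sum nabla _ hf (fun i ↦ ((h3 i).φ S).smul (hc i)) u).2, map_sum]
  refine Finset.sum_congr rfl fun i _ ↦ ?_
  rw [covAlong_smul_right nabla (hc i) (h3 i), covAlong_smul_right nabla (hc i) ((h3 i).φ S),
    covAlong_comp nabla (he i) hf, covAlong_comp nabla (S.mdifferentiableAt_φ (he i)) hf, hu,
    nabla_ξ_φ hnabla hS (he i)]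
  simp only [map_add, map_smul]

end Along

section Invariant

open Filter Topology

variable {E : Type*} [NormedAddCommGroup E] [NormedSpace ℝ E] [FiniteDimensional ℝ E]
  [CompleteSpace E]
  {H : Type*} [TopologicalSpace H] {I : ModelWithCorners ℝ E H} [I.Boundaryless]
  {M : Type*} [TopologicalSpace M] [ChartedSpace H M] [IsManifold I ∞ M]
  {E' : Type*} [NormedAddCommGroup E'] [NormedSpace ℝ E'] [FiniteDimensional ℝ E']
  [CompleteSpace E']
  {H' : Type*} [TopologicalSpace H'] {J : ModelWithCorners ℝ E' H'}
  {N : Type*} [TopologicalSpace N] [ChartedSpace H' N] [IsManifold J ∞ N]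
  [RiemannianBundle (fun p : N ↦ TangentSpace J p)]
  {f : M → N} (nabla : CovariantDerivative J E' (fun p : N ↦ TangentSpace J p))

lemma covAlong_neg (hf : ContMDiff I J ∞ f) (V : (x : M) → TangentSpace J (f x)) (x : M)
    (u : TangentSpace I x) :
    covAlong I J nabla f (-V) x u = -covAlong I J nabla f V x u := by
  have h1 : coordAlong J f (-V) x =ᶠ[𝓝 x] -coordAlong J f V x := by
    filter_upwards [eventually_mem_baseSet (J := J) hf.continuous.continuousAt] with y hy
    simp [coordAlong_eq _ hy]
  have h2 : nabla (FiberBundle.extend E' (-V x)) (f x) =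
      -nabla (FiberBundle.extend E' (V x)) (f x) := by
    rw [← neg_one_smul ℝ (V x), nabla_extend_smul, neg_one_smul]
  rw [covAlong_eq, covAlong_eq, mvfderiv_congr h1, mvfderiv_neg, Pi.neg_apply, h2]
  simp only [neg_apply, map_neg]
  abel

lemma normalConn_neg (hf : ContMDiff I J ∞ f) (X : (x : M) → TangentSpace I x)
    (V : (x : M) → TangentSpace J (f x)) (x : M) :
    normalConn I J nabla f X (-V) x = -normalConn I J nabla f X V x := by
  rw [normalConn, covAlong_neg nabla hf, ← neg_one_smul ℝ (covAlong _ _ _ _ _ _ _),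
    normalPart_smul, neg_one_smul]
  rfl

lemma normalConn_zero (hf : ContMDiff I J ∞ f) (X : (x : M) → TangentSpace I x) :
    normalConn I J nabla f X 0 = 0 := by
  funext x
  rw [normalConn, covAlong_zero nabla hf.continuous.continuousAt]
  exact normalPart_zero

lemma IsSmoothImmersion.tangentPart_zero (hf : IsSmoothImmersion I J f) (x : M) :
    tangentPart I J f x 0 = 0 :=
  hf.2 x (by rw [mfderiv_tangentPart, map_zero, map_zero])

lemma inducedConn_zero (hf : IsSmoothImmersion I J f) (X : (x : M) → TangentSpace I x) :
    inducedConn I J nabla f X 0 = 0 := by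
  funext x
  have h : push I J f (0 : (x : M) → TangentSpace I x) = 0 := by
    funext y
    simp [push]
  rw [inducedConn, h, covAlong_zero nabla hf.1.continuous.continuousAt]
  exact hf.tangentPart_zero x

lemma covForm_zero (hf : ContMDiff I J ∞ f) (X Y Z : (x : M) → TangentSpace I x) :
    covForm I J nabla f X 0 Y Z = 0 := by
  funext x
  rw [covForm]
  simp only [Pi.zero_apply, sub_zero]
  rw [normalConn_zero nabla hf]
  rfl

variable {nabla}

lemma IsTotallyGeodesic.secondFundField_eq_zero (h : IsTotallyGeodesic I J nabla f) :
    secondFundField I J nabla f = 0 := by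
  funext Y Z x
  exact h x (Y x) (Z x)

lemma IsTotallyGeodesic.isParallel (hf : ContMDiff I J ∞ f) (h : IsTotallyGeodesic I J nabla f) :
    IsParallel I J nabla f := by
  intro X Y Z _ _ _ x
  rw [h.secondFundField_eq_zero, covForm_zero nabla hf]
  rfl

lemma IsTotallyGeodesic.curvatureAction_eq_zero (hf : ContMDiff I J ∞ f)
    (h : IsTotallyGeodesic I J nabla f) (X Y Z U : (x : M) → TangentSpace I x) (x : M) :
    curvatureAction I J nabla f X Y Z U x = 0 := by
  have h0 (X : (x : M) → TangentSpace I x) : covForm I J nabla f X 0 = 0 := by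
    funext Y Z
    exact covForm_zero nabla hf X Y Z
  rw [curvatureAction, h.secondFundField_eq_zero]
  simp only [h0, Pi.zero_apply, sub_zero]

variable [IsContMDiffRiemannianBundle J ∞ E' (fun p : N ↦ TangentSpace J p)]
  {S : AlmostContactMetric J N} {β : N → ℝ}

variable (I f S) in
/-- The endomorphism `φ` restricted to the tangent spaces of an invariant submanifold. -/
def restrictedφ (x : M) (u : TangentSpace I x) : TangentSpace I x :=
  tangentPart I J f x (S.φ (f x) (mfderiv I J f x u))

lemma IsInvariant.mfderiv_restrictedReeb (hinv : IsInvariant I J f S) (x : M) :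
    mfderiv I J f x (restrictedReeb I J f S x) = S.ξ (f x) :=
  mfderiv_tangentPart_of_mem (hinv x).1

lemma IsInvariant.φ_mfderiv_mem (hinv : IsInvariant I J f S) (x : M) (u : TangentSpace I x) :
    S.φ (f x) (mfderiv I J f x u) ∈ tangentRange I J f x :=
  (hinv x).2 _ (mfderiv_mem_tangentRange u)

lemma IsInvariant.mfderiv_restrictedφ (hinv : IsInvariant I J f S) (x : M)
    (u : TangentSpace I x) :
    mfderiv I J f x (restrictedφ I f S x u) = S.φ (f x) (mfderiv I J f x u) :=
  mfderiv_tangentPart_of_mem (hinv.φ_mfderiv_mem x u)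

lemma IsInvariant.push_restrictedReeb (hinv : IsInvariant I J f S) :
    push I J f (restrictedReeb I J f S) = fun y ↦ S.ξ (f y) :=
  funext hinv.mfderiv_restrictedReeb

lemma IsInvariant.isSmoothField_restrictedReeb (hf : IsSmoothImmersion I J f)
    (hinv : IsInvariant I J f S) : IsSmoothField I (restrictedReeb I J f S) := by
  refine isSmoothField_of_push hf ?_
  rw [hinv.push_restrictedReeb]
  exact ContMDiff.comp (g := fun q ↦ (⟨q, S.ξ q⟩ : TangentBundle J N)) S.smooth_ξ hf.1

lemma IsInvariant.restrictedφ_restrictedφ (hf : IsSmoothImmersion I J f)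
    (hinv : IsInvariant I J f S) (x : M) (u : TangentSpace I x) :
    restrictedφ I f S x (restrictedφ I f S x u) =
      -u + S.η (f x) (mfderiv I J f x u) • restrictedReeb I J f S x := by
  apply hf.2 x
  rw [hinv.mfderiv_restrictedφ, hinv.mfderiv_restrictedφ, S.φ_sq, map_add, map_neg, map_smul,
    hinv.mfderiv_restrictedReeb]

lemma IsInvariant.restrictedφ_restrictedReeb (hf : IsSmoothImmersion I J f)
    (hinv : IsInvariant I J f S) (x : M) :
    restrictedφ I f S x (restrictedReeb I J f S x) = 0 := by
  apply hf.2 x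
  rw [hinv.mfderiv_restrictedφ, hinv.mfderiv_restrictedReeb, S.φ_ξ, map_zero]

lemma IsInvariant.covAlong_restrictedReeb (hf : IsSmoothImmersion I J f)
    (hinv : IsInvariant I J f S) (hS : IsSQSasakian S nabla β) (x : M) (u : TangentSpace I x) :
    covAlong I J nabla f (push I J f (restrictedReeb I J f S)) x u =
      -(β (f x) • S.φ (f x) (mfderiv I J f x u)) := by
  rw [hinv.push_restrictedReeb, covAlong_comp nabla (S.smooth_ξ.mdifferentiableAt _)
    (hf.1.mdifferentiable (by simp) x), hS.nabla_ξ]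

lemma IsInvariant.inducedConn_restrictedReeb (hf : IsSmoothImmersion I J f)
    (hinv : IsInvariant I J f S) (hS : IsSQSasakian S nabla β) (X : (x : M) → TangentSpace I x) :
    inducedConn I J nabla f X (restrictedReeb I J f S) =
      fun x ↦ -(β (f x) • restrictedφ I f S x (X x)) := by
  funext x
  apply hf.2 x
  rw [inducedConn, hinv.covAlong_restrictedReeb hf hS, mfderiv_tangentPart_of_mem
    (Submodule.neg_mem _ (Submodule.smul_mem _ _ (hinv.φ_mfderiv_mem x _))), map_neg, map_smul,
    hinv.mfderiv_restrictedφ]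

lemma IsInvariant.secondFundForm_restrictedReeb_right (hf : IsSmoothImmersion I J f)
    (hinv : IsInvariant I J f S) (hS : IsSQSasakian S nabla β) (x : M) (u : TangentSpace I x) :
    secondFundForm I J nabla f x u (restrictedReeb I J f S x) = 0 := by
  rw [← normalPart_covAlong_push nabla hf.1
    ((hinv.isSmoothField_restrictedReeb hf).mdifferentiableAt x), hinv.covAlong_restrictedReeb hf hS]
  exact normalPart_of_mem
    (Submodule.neg_mem _ (Submodule.smul_mem _ _ (hinv.φ_mfderiv_mem x _)))

lemma IsInvariant.secondFundForm_restrictedReeb_left (htor : nabla.torsion = 0)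
    (hf : IsSmoothImmersion I J f)
    (hinv : IsInvariant I J f S) (hS : IsSQSasakian S nabla β) (x : M) (u : TangentSpace I x) :
    secondFundForm I J nabla f x (restrictedReeb I J f S x) u = 0 := by
  rw [secondFundForm_symm nabla htor hf.1, hinv.secondFundForm_restrictedReeb_right hf hS]

lemma IsInvariant.secondFundForm_restrictedφ_restrictedφ (htor : nabla.torsion = 0)
    (hf : IsSmoothImmersion I J f)
    (hinv : IsInvariant I J f S) (hS : IsSQSasakian S nabla β) (x : M) (u v : TangentSpace I x) :
    secondFundForm I J nabla f x u (restrictedφ I f S x (restrictedφ I f S x v)) =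
      -secondFundForm I J nabla f x u v := by
  rw [hinv.restrictedφ_restrictedφ hf, secondFundForm_add_right nabla htor hf.1,
    secondFundForm_smul_right nabla htor hf.1, hinv.secondFundForm_restrictedReeb_right hf hS,
    ← neg_one_smul ℝ v, secondFundForm_smul_right nabla htor hf.1]
  simp

lemma secondFundForm_zero_right (htor : nabla.torsion = 0) (hf : ContMDiff I J ∞ f) (x : M)
    (u : TangentSpace I x) : secondFundForm I J nabla f x u 0 = 0 := by
  simpa using secondFundForm_smul_right nabla htor hf 0 u 0

lemma IsInvariant.covForm_restrictedReeb (hf : IsSmoothImmersion I J f)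
    (hinv : IsInvariant I J f S) (hS : IsSQSasakian S nabla β)
    (X Z : (x : M) → TangentSpace I x) :
    covForm I J nabla f X (secondFundField I J nabla f) Z (restrictedReeb I J f S) =
      -secondFundField I J nabla f Z (inducedConn I J nabla f X (restrictedReeb I J f S)) := by
  have h0 (Z : (x : M) → TangentSpace I x) :
      secondFundField I J nabla f Z (restrictedReeb I J f S) = 0 := by
    funext x
    exact hinv.secondFundForm_restrictedReeb_right hf hS x (Z x)
  funext x
  rw [covForm, h0, h0, normalConn_zero nabla hf.1]
  simp

lemma IsInvariant.covForm_restrictedReeb_apply (htor : nabla.torsion = 0)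
    (hf : IsSmoothImmersion I J f)
    (hinv : IsInvariant I J f S) (hS : IsSQSasakian S nabla β)
    (X Z : (x : M) → TangentSpace I x) (x : M) :
    covForm I J nabla f X (secondFundField I J nabla f) Z (restrictedReeb I J f S) x =
      β (f x) • secondFundForm I J nabla f x (Z x) (restrictedφ I f S x (X x)) := by
  rw [hinv.covForm_restrictedReeb hf hS, hinv.inducedConn_restrictedReeb hf hS, Pi.neg_apply,
    secondFundField, ← neg_smul, secondFundForm_smul_right nabla htor hf.1, neg_smul, neg_neg]

lemma covForm_secondFundField_zero (htor : nabla.torsion = 0) (hf : IsSmoothImmersion I J f)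
    (X Z : (x : M) → TangentSpace I x) (x : M) :
    covForm I J nabla f X (secondFundField I J nabla f) Z 0 x = 0 := by
  have h0 (Z : (x : M) → TangentSpace I x) : secondFundField I J nabla f Z 0 = 0 := by
    funext x
    exact secondFundForm_zero_right htor hf.1 x (Z x)
  rw [covForm, inducedConn_zero nabla hf, h0, h0, normalConn_zero nabla hf.1]
  simp

lemma IsInvariant.inducedConn_restrictedReeb_self (hf : IsSmoothImmersion I J f)
    (hinv : IsInvariant I J f S) (hS : IsSQSasakian S nabla β) :
    inducedConn I J nabla f (restrictedReeb I J f S) (restrictedReeb I J f S) = 0 := by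
  rw [hinv.inducedConn_restrictedReeb hf hS]
  funext x
  rw [hinv.restrictedφ_restrictedReeb hf, smul_zero, neg_zero]
  rfl

/-- The curvature of the induced connection satisfies `R(X, ξ)ξ = -β² φ² X`. -/
lemma IsInvariant.curvature_restrictedReeb [T2Space N] (hnabla : IsLeviCivita J N nabla)
    (hf : IsSmoothImmersion I J f) (hinv : IsInvariant I J f S) (hS : IsSQSasakian S nabla β)
    {X : (x : M) → TangentSpace I x} (hX : IsSmoothField I X) (x : M) :
    inducedConn I J nabla f (restrictedReeb I J f S)
        (inducedConn I J nabla f X (restrictedReeb I J f S)) x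
      + inducedConn I J nabla f (VectorField.mlieBracket I X (restrictedReeb I J f S))
        (restrictedReeb I J f S) x =
      β (f x) ^ 2 • restrictedφ I f S x (restrictedφ I f S x (X x)) := by
  have hfd := hf.1.mdifferentiable (by simp) x
  have hβ := hS.smooth_β.mdifferentiable (by simp) (f x)
  have hXd := hX.mdifferentiableAt x
  have hφ := (diffAlongAt_push hf.1 hXd).φ S
  have hβf : MDifferentiableAt I 𝓘(ℝ, ℝ) (fun y ↦ β (f y)) x := hβ.comp x hfd
  have h1 : push I J f (inducedConn I J nabla f X (restrictedReeb I J f S)) =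
      -fun y ↦ β (f y) • S.φ (f y) (push I J f X y) := by
    rw [hinv.inducedConn_restrictedReeb hf hS]
    funext y
    rw [push, map_neg, map_smul, hinv.mfderiv_restrictedφ]
    rfl
  have h2 : mvfderiv I (fun y ↦ β (f y)) x (restrictedReeb I J f S x) = 0 := by
    have h := mvfderiv_comp_apply x hβ hfd (restrictedReeb I J f S x)
    rw [hinv.mfderiv_restrictedReeb] at h
    exact h.trans (hS.ξ_β (f x))
  have h3 := covAlong_push_sub nabla hnabla.1 hf.1 hXd
    ((hinv.isSmoothField_restrictedReeb hf).mdifferentiableAt x)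
  rw [hinv.covAlong_restrictedReeb hf hS, sub_eq_iff_eq_add, ← sub_eq_iff_eq_add'] at h3
  have h4 : covAlong I J nabla f
      (push I J f (inducedConn I J nabla f X (restrictedReeb I J f S))) x
        (restrictedReeb I J f S x) = β (f x) ^ 2 • S.φ (f x) (S.φ (f x) (mfderiv I J f x (X x))) +
          β (f x) • S.φ (f x) (mfderiv I J f x
            (VectorField.mlieBracket I X (restrictedReeb I J f S) x)) := by
    rw [h1, covAlong_neg nabla hf.1, covAlong_smul_right nabla hβf hφ, h2,
      covAlong_φ_of_mfderiv_eq_ξ hnabla hS (diffAlongAt_push hf.1 hXd)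
        (hinv.mfderiv_restrictedReeb x), ← h3]
    simp only [map_sub, map_neg, map_smul]
    module
  have h5 : covAlong I J nabla f
      (push I J f (inducedConn I J nabla f X (restrictedReeb I J f S))) x
        (restrictedReeb I J f S x) ∈ tangentRange I J f x := by
    rw [h4]
    exact Submodule.add_mem _ (Submodule.smul_mem _ _ ((hinv x).2 _ (hinv.φ_mfderiv_mem x _)))
      (Submodule.smul_mem _ _ (hinv.φ_mfderiv_mem x _))
  apply hf.2 x
  rw [hinv.inducedConn_restrictedReeb hf hS (VectorField.mlieBracket I X _), map_add, inducedConn,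
    mfderiv_tangentPart_of_mem h5, h4]
  simp only [map_neg, map_smul, hinv.mfderiv_restrictedφ]
  abel

lemma IsInvariant.curvatureAction_restrictedReeb [T2Space N] (hnabla : IsLeviCivita J N nabla)
    (hf : IsSmoothImmersion I J f) (hinv : IsInvariant I J f S) (hS : IsSQSasakian S nabla β)
    {X : (x : M) → TangentSpace I x} (hX : IsSmoothField I X) (Z : (x : M) → TangentSpace I x)
    (x : M) :
    curvatureAction I J nabla f X (restrictedReeb I J f S) Z (restrictedReeb I J f S) x =
      -(β (f x) ^ 2 • secondFundForm I J nabla f x (Z x) (X x)) := by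
  set ξ := restrictedReeb I J f S
  have h0 (Z : (x : M) → TangentSpace I x) :
      covForm I J nabla f ξ (secondFundField I J nabla f) Z ξ = 0 := by
    rw [hinv.covForm_restrictedReeb hf hS, hinv.inducedConn_restrictedReeb_self hf hS]
    funext y
    rw [Pi.neg_apply, secondFundField, Pi.zero_apply, secondFundForm_zero_right hnabla.1 hf.1]
    simp
  have h1 : covForm I J nabla f X (covForm I J nabla f ξ (secondFundField I J nabla f)) Z ξ x =
      -covForm I J nabla f ξ (secondFundField I J nabla f) Z (inducedConn I J nabla f X ξ) x := by
    rw [covForm, h0, h0, normalConn_zero nabla hf.1]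
    simp
  have h2 : covForm I J nabla f ξ (covForm I J nabla f X (secondFundField I J nabla f)) Z ξ x =
      normalConn I J nabla f ξ (covForm I J nabla f X (secondFundField I J nabla f) Z ξ) x
      - covForm I J nabla f X (secondFundField I J nabla f) (inducedConn I J nabla f ξ Z) ξ x := by
    rw [covForm, hinv.inducedConn_restrictedReeb_self hf hS,
      covForm_secondFundField_zero hnabla.1 hf, sub_zero]
  rw [curvatureAction, h1, h2]
  simp only [ξ, hinv.covForm_restrictedReeb hf hS]
  rw [normalConn_neg nabla hf.1, covForm]
  have h3 := congrArg (secondFundForm I J nabla f x (Z x))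
    (hinv.curvature_restrictedReeb hnabla hf hS hX x)
  rw [secondFundForm_add_right nabla hnabla.1 hf.1, secondFundForm_smul_right nabla hnabla.1 hf.1,
    hinv.secondFundForm_restrictedφ_restrictedφ hnabla.1 hf hS, smul_neg] at h3
  rw [← h3]
  simp only [Pi.neg_apply, secondFundField]
  abel

lemma IsInvariant.tachibana_restrictedReeb (htor : nabla.torsion = 0)
    (hf : IsSmoothImmersion I J f) (hinv : IsInvariant I J f S) (hS : IsSQSasakian S nabla β)
    (x : M) (Z X : TangentSpace I x) :
    tachibana I J nabla f x Z (restrictedReeb I J f S x) X (restrictedReeb I J f S x) =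
      secondFundForm I J nabla f x X Z := by
  have h : inducedMetric I J f x (restrictedReeb I J f S x) (restrictedReeb I J f S x) = 1 := by
    rw [inducedMetric, hinv.mfderiv_restrictedReeb, S.inner_ξ, S.η_ξ]
  rw [tachibana, h]
  simp only [hinv.secondFundForm_restrictedReeb_right hf hS,
    hinv.secondFundForm_restrictedReeb_left htor hf hS]
  simp

end Invariant

section Implications

variable {E : Type*} [NormedAddCommGroup E] [NormedSpace ℝ E] [FiniteDimensional ℝ E]
  [CompleteSpace E]
  {H : Type*} [TopologicalSpace H] {I : ModelWithCorners ℝ E H} [I.Boundaryless]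
  {M : Type*} [TopologicalSpace M] [ChartedSpace H M] [IsManifold I ∞ M]
  {E' : Type*} [NormedAddCommGroup E'] [NormedSpace ℝ E'] [FiniteDimensional ℝ E']
  [CompleteSpace E']
  {H' : Type*} [TopologicalSpace H'] {J : ModelWithCorners ℝ E' H'}
  {N : Type*} [TopologicalSpace N] [ChartedSpace H' N] [IsManifold J ∞ N]
  [RiemannianBundle (fun p : N ↦ TangentSpace J p)]
  [IsContMDiffRiemannianBundle J ∞ E' (fun p : N ↦ TangentSpace J p)]
  {f : M → N} {nabla : CovariantDerivative J E' (fun p : N ↦ TangentSpace J p)}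
  {S : AlmostContactMetric J N} {β : N → ℝ}

variable (I f S) in
/-- The contact form `η` pulled back to the submanifold. -/
def pullbackη (x : M) : TangentSpace I x →L[ℝ] ℝ :=
  (S.η (f x)).comp (mfderiv I J f x)

lemma isSmoothOneForm_pullbackη (hf : ContMDiff I J ∞ f) :
    IsSmoothOneForm I (pullbackη I f S) := by
  intro X hX
  have hξ : ContMDiff I J.tangent ∞ (fun y ↦ (⟨f y, S.ξ (f y)⟩ : TangentBundle J N)) :=
    ContMDiff.comp (g := fun q ↦ (⟨q, S.ξ q⟩ : TangentBundle J N)) S.smooth_ξ hf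
  have h := ContMDiff.inner_bundle (E := fun p : N ↦ TangentSpace J p)
    (contMDiff_push hf hX) hξ
  simp only [S.inner_ξ] at h
  exact h

lemma IsInvariant.pullbackη_restrictedReeb (hinv : IsInvariant I J f S) (x : M) :
    pullbackη I f S x (restrictedReeb I J f S x) = 1 := by
  rw [pullbackη, ContinuousLinearMap.comp_apply, hinv.mfderiv_restrictedReeb, S.η_ξ]

/-- A totally geodesic invariant submanifold is Chaki-pseudo parallel, with `α = η`. -/
lemma IsTotallyGeodesic.isChakiCase (hf : IsSmoothImmersion I J f) (hinv : IsInvariant I J f S)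
    (h : IsTotallyGeodesic I J nabla f) : IsChakiCase I J nabla f S β := by
  refine ⟨pullbackη I f S, ⟨isSmoothOneForm_pullbackη hf.1, fun x hx ↦ ?_,
    fun X Y Z hX hY hZ x ↦ ?_⟩, fun x ↦ ?_⟩
  · have h1 := hinv.pullbackη_restrictedReeb x
    rw [hx] at h1
    exact zero_ne_one h1
  · rw [h.isParallel hf.1 X Y Z hX hY hZ, h, h, h]
    simp
  · rw [hinv.pullbackη_restrictedReeb]
    positivity

lemma IsTotallyGeodesic.meanCurvature_eq_zero (h : IsTotallyGeodesic I J nabla f) (x : M) :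
    meanCurvature I J nabla f x = 0 := by
  rw [meanCurvature, Finset.sum_eq_zero fun i _ ↦ h x _ _, smul_zero]

lemma IsTotallyGeodesic.notMem_nonUmbilicSet (h : IsTotallyGeodesic I J nabla f) (x : M) :
    x ∉ nonUmbilicSet I J nabla f := by
  rintro ⟨u, v, huv⟩
  exact huv (by rw [h, h.meanCurvature_eq_zero, smul_zero, sub_zero])

lemma IsTotallyGeodesic.isDeszczCase (h : IsTotallyGeodesic I J nabla f) :
    IsDeszczCase I J nabla f β :=
  ⟨0, fun _ _ _ _ _ _ _ _ x ↦ (h.notMem_nonUmbilicSet x x.2).elim,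
    fun x ↦ (h.notMem_nonUmbilicSet x x.2).elim⟩

/-- If `β h(v, φ u) = a h(u, v)` and `a² + β² ≠ 0`, then `h` vanishes at the point. -/
lemma IsInvariant.secondFundForm_eq_zero (htor : nabla.torsion = 0)
    (hf : IsSmoothImmersion I J f) (hinv : IsInvariant I J f S) (hS : IsSQSasakian S nabla β)
    {x : M} {a : ℝ} (ha : a ^ 2 + β (f x) ^ 2 ≠ 0)
    (h : ∀ u v : TangentSpace I x, β (f x) • secondFundForm I J nabla f x v
      (restrictedφ I f S x u) = a • secondFundForm I J nabla f x u v)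
    (u v : TangentSpace I x) : secondFundForm I J nabla f x u v = 0 := by
  have h1 := h (restrictedφ I f S x u) v
  rw [hinv.secondFundForm_restrictedφ_restrictedφ htor hf hS,
    secondFundForm_symm nabla htor hf.1 _ v] at h1
  have h2 : (a ^ 2 + β (f x) ^ 2) • secondFundForm I J nabla f x u v = 0 := by
    calc (a ^ 2 + β (f x) ^ 2) • secondFundForm I J nabla f x u v
        = a • a • secondFundForm I J nabla f x u v
          + β (f x) ^ 2 • secondFundForm I J nabla f x u v := by module
      _ = β (f x) • a • secondFundForm I J nabla f x v (restrictedφ I f S x u)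
          + β (f x) ^ 2 • secondFundForm I J nabla f x v u := by
        rw [← h, smul_comm, secondFundForm_symm nabla htor hf.1 u v]
      _ = 0 := by rw [← h1]; module
  exact (smul_eq_zero.1 h2).resolve_left ha

lemma IsChakiCase.isTotallyGeodesic [T2Space M] (htor : nabla.torsion = 0)
    (hf : IsSmoothImmersion I J f) (hinv : IsInvariant I J f S) (hS : IsSQSasakian S nabla β)
    (h : IsChakiCase I J nabla f S β) : IsTotallyGeodesic I J nabla f := by
  obtain ⟨α, ⟨-, -, hα⟩, hne⟩ := h
  refine fun x ↦ hinv.secondFundForm_eq_zero htor hf hS (hne x) fun u v ↦ ?_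
  obtain ⟨X, hX, rfl, -⟩ := exists_smoothField_extend u
  obtain ⟨Z, hZ, rfl, -⟩ := exists_smoothField_extend v
  have h1 := hα X Z _ hX hZ (hinv.isSmoothField_restrictedReeb hf) x
  rw [hinv.covForm_restrictedReeb_apply htor hf hS,
    hinv.secondFundForm_restrictedReeb_right hf hS,
    hinv.secondFundForm_restrictedReeb_right hf hS, smul_zero, smul_zero, zero_add, zero_add] at h1
  exact h1

lemma IsParallel.isTotallyGeodesic [T2Space M] (htor : nabla.torsion = 0)
    (hf : IsSmoothImmersion I J f) (hinv : IsInvariant I J f S) (hS : IsSQSasakian S nabla β)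
    (hβ : ∀ x, β (f x) ≠ 0) (h : IsParallel I J nabla f) : IsTotallyGeodesic I J nabla f := by
  refine fun x ↦ hinv.secondFundForm_eq_zero (a := 0) htor hf hS (by simpa using hβ x)
    fun u v ↦ ?_
  obtain ⟨X, hX, rfl, -⟩ := exists_smoothField_extend u
  obtain ⟨Z, hZ, rfl, -⟩ := exists_smoothField_extend v
  rw [← hinv.covForm_restrictedReeb_apply htor hf hS, zero_smul]
  exact h X Z _ hX hZ (hinv.isSmoothField_restrictedReeb hf) x

lemma IsSemiparallel.isTotallyGeodesic [T2Space M] [T2Space N] (hnabla : IsLeviCivita J N nabla)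
    (hf : IsSmoothImmersion I J f) (hinv : IsInvariant I J f S) (hS : IsSQSasakian S nabla β)
    (hβ : ∀ x, β (f x) ≠ 0) (h : IsSemiparallel I J nabla f) : IsTotallyGeodesic I J nabla f := by
  intro x u v
  obtain ⟨X, hX, rfl, -⟩ := exists_smoothField_extend v
  obtain ⟨Z, hZ, rfl, -⟩ := exists_smoothField_extend u
  have hξ := hinv.isSmoothField_restrictedReeb hf
  have h1 := h X _ Z _ hX hξ hZ hξ x
  rw [hinv.curvatureAction_restrictedReeb hnabla hf hS hX, neg_eq_zero] at h1
  exact (smul_eq_zero.1 h1).resolve_left (pow_ne_zero 2 (hβ x))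

lemma IsDeszczCase.nonUmbilicSet_eq_empty [T2Space M] [T2Space N]
    (hnabla : IsLeviCivita J N nabla)
    (hf : IsSmoothImmersion I J f) (hinv : IsInvariant I J f S) (hS : IsSQSasakian S nabla β)
    (h : IsDeszczCase I J nabla f β) (x : M) : x ∉ nonUmbilicSet I J nabla f := by
  intro hx
  obtain ⟨L, hL, hne⟩ := h
  have h0 (u v : TangentSpace I x) : secondFundForm I J nabla f x u v = 0 := by
    obtain ⟨X, hX, rfl, -⟩ := exists_smoothField_extend u
    obtain ⟨Z, hZ, rfl, -⟩ := exists_smoothField_extend v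
    have hξ := hinv.isSmoothField_restrictedReeb hf
    have h1 := hL X _ Z _ hX hξ hZ hξ ⟨x, hx⟩
    rw [hinv.curvatureAction_restrictedReeb hnabla hf hS hX,
      hinv.tachibana_restrictedReeb hnabla.1 hf hS,
      secondFundForm_symm nabla hnabla.1 hf.1 (Z x), neg_eq_iff_add_eq_zero, ← add_smul,
      add_comm] at h1
    exact (smul_eq_zero.1 h1).resolve_left (hne ⟨x, hx⟩)
  obtain ⟨u, v, huv⟩ := hx
  refine huv ?_
  rw [h0, meanCurvature, Finset.sum_eq_zero fun i _ ↦ h0 _ _, smul_zero, smul_zero, sub_zero]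

lemma IsDeszczCase.isTotallyGeodesic [T2Space M] [T2Space N] (hnabla : IsLeviCivita J N nabla)
    (hf : IsSmoothImmersion I J f) (hinv : IsInvariant I J f S) (hS : IsSQSasakian S nabla β)
    (h : IsDeszczCase I J nabla f β) : IsTotallyGeodesic I J nabla f := by
  intro x
  have humb (u v : TangentSpace I x) : secondFundForm I J nabla f x u v =
      inducedMetric I J f x u v • meanCurvature I J nabla f x := by
    by_contra huv
    exact h.nonUmbilicSet_eq_empty hnabla hf hinv hS x ⟨u, v, sub_ne_zero.2 huv⟩
  have hH : meanCurvature I J nabla f x = 0 := by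
    have h1 := humb (restrictedReeb I J f S x) (restrictedReeb I J f S x)
    rwa [hinv.secondFundForm_restrictedReeb_right hf hS, inducedMetric,
      hinv.mfderiv_restrictedReeb, S.inner_ξ, S.η_ξ, one_smul, eq_comm] at h1
  intro u v
  rw [humb, hH, smul_zero]

end Implications

end SQSasakian

end

theorem theorem3p3 (n m : ℕ)
    -- the ambient Riemannian manifold of dimension `2n + 1`
    (N : Type*) [TopologicalSpace N] [T2Space N] [SecondCountableTopology N]
    [ChartedSpace (EuclideanSpace ℝ (Fin (2 * n + 1))) N] [IsManifold (𝓡 (2 * n + 1)) ∞ N]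
    [RiemannianBundle (fun p : N ↦ TangentSpace (𝓡 (2 * n + 1)) p)]
    [IsContMDiffRiemannianBundle (𝓡 (2 * n + 1)) ∞ (EuclideanSpace ℝ (Fin (2 * n + 1)))
      (fun p : N ↦ TangentSpace (𝓡 (2 * n + 1)) p)]
    -- its Levi-Civita connection and its special quasi-Sasakian structure
    (nabla : CovariantDerivative (𝓡 (2 * n + 1)) (EuclideanSpace ℝ (Fin (2 * n + 1)))
      (fun p : N ↦ TangentSpace (𝓡 (2 * n + 1)) p))
    (hnabla : SQSasakian.IsLeviCivita (𝓡 (2 * n + 1)) N nabla)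
    (S : SQSasakian.AlmostContactMetric (𝓡 (2 * n + 1)) N) (β : N → ℝ)
    (hS : SQSasakian.IsSQSasakian S nabla β)
    -- the invariant submanifold, of dimension `2m + 1`
    (M : Type*) [TopologicalSpace M] [T2Space M] [SecondCountableTopology M]
    [ChartedSpace (EuclideanSpace ℝ (Fin (2 * m + 1))) M] [IsManifold (𝓡 (2 * m + 1)) ∞ M]
    (f : M → N) (hf : SQSasakian.IsSmoothImmersion (𝓡 (2 * m + 1)) (𝓡 (2 * n + 1)) f)
    (hinv : SQSasakian.IsInvariant (𝓡 (2 * m + 1)) (𝓡 (2 * n + 1)) f S) :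
    [SQSasakian.IsTotallyGeodesic (𝓡 (2 * m + 1)) (𝓡 (2 * n + 1)) nabla f,
      SQSasakian.IsChakiCase (𝓡 (2 * m + 1)) (𝓡 (2 * n + 1)) nabla f S β,
      SQSasakian.IsDeszczCase (𝓡 (2 * m + 1)) (𝓡 (2 * n + 1)) nabla f β].TFAE
    ∧ (SQSasakian.IsTotallyGeodesic (𝓡 (2 * m + 1)) (𝓡 (2 * n + 1)) nabla f →
        SQSasakian.IsParallel (𝓡 (2 * m + 1)) (𝓡 (2 * n + 1)) nabla f
        ∧ SQSasakian.IsSemiparallel (𝓡 (2 * m + 1)) (𝓡 (2 * n + 1)) nabla f)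
    ∧ ((∀ x, β (f x) ≠ 0) →
      [SQSasakian.IsTotallyGeodesic (𝓡 (2 * m + 1)) (𝓡 (2 * n + 1)) nabla f,
        SQSasakian.IsParallel (𝓡 (2 * m + 1)) (𝓡 (2 * n + 1)) nabla f,
        SQSasakian.IsSemiparallel (𝓡 (2 * m + 1)) (𝓡 (2 * n + 1)) nabla f,
        SQSasakian.IsChakiCase (𝓡 (2 * m + 1)) (𝓡 (2 * n + 1)) nabla f S β,
        SQSasakian.IsDeszczCase (𝓡 (2 * m + 1)) (𝓡 (2 * n + 1)) nabla f β].TFAE) := by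

  have htor := hnabla.1
  have h14 (h : SQSasakian.IsTotallyGeodesic (𝓡 (2 * m + 1)) (𝓡 (2 * n + 1)) nabla f) :
      SQSasakian.IsChakiCase (𝓡 (2 * m + 1)) (𝓡 (2 * n + 1)) nabla f S β :=
    h.isChakiCase hf hinv
  have h41 (h : SQSasakian.IsChakiCase (𝓡 (2 * m + 1)) (𝓡 (2 * n + 1)) nabla f S β) :=
    h.isTotallyGeodesic htor hf hinv hS
  have h15 (h : SQSasakian.IsTotallyGeodesic (𝓡 (2 * m + 1)) (𝓡 (2 * n + 1)) nabla f) :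
      SQSasakian.IsDeszczCase (𝓡 (2 * m + 1)) (𝓡 (2 * n + 1)) nabla f β :=
    h.isDeszczCase
  have h51 (h : SQSasakian.IsDeszczCase (𝓡 (2 * m + 1)) (𝓡 (2 * n + 1)) nabla f β) :=
    h.isTotallyGeodesic hnabla hf hinv hS
  have h12 (h : SQSasakian.IsTotallyGeodesic (𝓡 (2 * m + 1)) (𝓡 (2 * n + 1)) nabla f) :=
    h.isParallel hf.1
  have h13 (h : SQSasakian.IsTotallyGeodesic (𝓡 (2 * m + 1)) (𝓡 (2 * n + 1)) nabla f) :
      SQSasakian.IsSemiparallel (𝓡 (2 * m + 1)) (𝓡 (2 * n + 1)) nabla f :=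
    fun X Y Z U _ _ _ _ x ↦ h.curvatureAction_eq_zero hf.1 X Y Z U x
  refine ⟨?_, fun h ↦ ⟨h12 h, h13 h⟩, fun hβ ↦ ?_⟩
  · tfae_have 1 ↔ 2 := ⟨h14, h41⟩
    tfae_have 1 ↔ 3 := ⟨h15, h51⟩
    tfae_finish
  · tfae_have 1 ↔ 2 := ⟨h12, fun h ↦ h.isTotallyGeodesic htor hf hinv hS hβ⟩
    tfae_have 1 ↔ 3 := ⟨h13, fun h ↦ h.isTotallyGeodesic hnabla hf hinv hS hβ⟩
    tfae_have 1 ↔ 4 := ⟨h14, h41⟩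
    tfae_have 1 ↔ 5 := ⟨h15, h51⟩
    tfae_finish
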